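/- A finite chain ring is a finite (not necessarily commutative) ring whose left ideals are totally ordered by inclusion and whose right ideals are totally ordered by inclusion. Its unique maximal ideal is generated by an element $\pi$; its nilpotency index is the least positive integer $s$ with $\pi^s=0$, and its residue field is $\mathcal{R}/\langle\pi\rangle$. For $n,\ell\ge 0$ with $\ell\le sn$ let $\psi_{\mathcal{R}}(n,\ell)$ denote the proportion of free modules among all left $\mathcal{R}$-submodules of $\mathcal{R}^n$ of length $\ell$ (length meaning composition length). For a positive integer $q \geq 2$ put $(1/q)_\infty=\prod_{i=1}^{\infty}(1-q^{-i})$. 1. Fix integers $n,s,\ell$ with $s\ge 1$, $s\mid \ell$ and $0\le\ell\le sn$. As $q\to\infty$, the density of free submodules of length $\ell$ in $\mathcal{R}^n$ is $1$: for every sequence $(\mathcal{R}_j)$ of finite chain rings of nilpotency index $s$ whose residue fields have orders $q_j\to\infty$, $$\lim_{j\to\infty}\psi_{\mathcal{R}_j}(n,\ell)=1 .$$ 2. Fix integers $0\le k\le n$ and the order $q$ of the residue field. As $s\to\infty$, the density of free submodules of length $\ell=sk$ in $\mathcal{R}^n$ exists and is at least $(1/q)_\infty$: there is a real number $d\ge(1/q)_\infty$,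 depending only on $n,k,q$, such that for every sequence $(\mathcal{R}_j)$ of finite chain rings with residue field of order $q$ and nilpotency indices $s_j\to\infty$, $$\lim_{j\to\infty}\psi_{\mathcal{R}_j}(n,s_jk)=d .$$ -/

import Mathlib

open Filter Topology

universe u

/-- `R` is a finite (not necessarily commutative) chain ring whose residue field has order `q` and
whose nilpotency index is `s`. The chain conditions make the maximal left ideal generated by `π`
the unique maximal left ideal. -/
structure IsFiniteChainRing (R : Type u) [Ring R] (q s : ℕ) : Prop where
  finite : Finite R
  left_chain : ∀ I J : Submodule R R, I ≤ J ∨ J ≤ I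
  right_chain : ∀ I J : Submodule Rᵐᵒᵖ R, I ≤ J ∨ J ≤ I
  exists_generator : ∃ π : R, (Ideal.span {π}).IsMaximal ∧
    Nat.card (R ⧸ Ideal.span {π}) = q ∧ IsLeast {t : ℕ | 0 < t ∧ π ^ t = 0} s

/-- The left submodules of `R ^ n` of length `ℓ`. -/
def submodulesOfLength (R : Type u) [Ring R] (n ℓ : ℕ) : Set (Submodule R (Fin n → R)) :=
  {N | Module.length R N = ℓ}

/-- The free left submodules of `R ^ n` of length `ℓ`. -/
def freeSubmodulesOfLength (R : Type u) [Ring R] (n ℓ : ℕ) : Set (Submodule R (Fin n → R)) :=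
  {N | N ∈ submodulesOfLength R n ℓ ∧ Module.Free R N}

/-- The probability that a uniformly random left submodule of `R ^ n` of length `ℓ` is free. -/
noncomputable def freeProbability (R : Type u) [Ring R] (n ℓ : ℕ) : ℝ :=
  ((freeSubmodulesOfLength R n ℓ).ncard : ℝ) / ((submodulesOfLength R n ℓ).ncard : ℝ)

/-- The infinite `x`-Pochhammer symbol `(a; x)_∞`, an absolutely convergent product for
`|x| < 1`. -/
noncomputable def qPochhammerInf (a x : ℝ) : ℝ := ∏' i : ℕ, (1 - a * x ^ i)

/-- Euler's function `(x)_∞ = (x; x)_∞`. -/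
noncomputable def eulerFunction (x : ℝ) : ℝ := qPochhammerInf x x

/-! Put `x = 1/q`, `n = k + r`, `ℓ = s k`. To a submodule `N` of `R ^ n` attach its profile `m_0 ≤ …
≤ m_{s-1} ≤ n`, the lengths of the successive quotients of the filtration `N ∩ π^j R^n`; these add
up to `ℓ`. Rebuilding `N` from the deepest layer upwards, each layer contributes `q^(m(n-m))` times
a Gaussian binomial in `x` (`cast_ncard_fiber`). The binomials telescope, so the submodules are
counted by a weighted sum over chains (`cast_ncard_submodulesOfLength`). The free ones are those
with `m_0 = k` (`freeSubmodulesOfLength_eq`), which forces the constant chain. Completing the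
square, `m(n-m) = k² + (n-2k)m - (m-k)²`; the first two terms give every chain the same factor, and
the density becomes the reciprocal of a normalised chain sum with weights `x^((m-k)²)`
(`freeProbability_eq_freeRatio`).

To estimate that sum, cut each chain at `k`: the entries `k - d` with `d > 0` and the entries `k +
d` with `d ≥ 0` have the same total deviation `E`. Treating the two halves as independent can only
increase the sum, because `(x;x)_a (x;x)_b ≤ (x;x)_{a+b}`, and is exact for chains passing through
`k`. Hence the chain sum with `s` entries lies between `splitSum` for `s - 1` and for `s`. By a
Hall-type recursion, each half is at most `x^E / (x;x)_E` after normalisation (`hallSum_le`). For `x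
≤ 1/2` this is at most 1, and `∑ x^E / (x;x)_E = 1 / (x;x)_L` bounds the product of the halves
summed over `E`. So the density is at least some `(x;x)_L`, hence at least both `1 - 2x` and
`(x)_∞`. The first bound settles `q → ∞`. For `s → ∞`, `splitSum` is increasing and bounded, and the
squeeze gives a limit depending only on `k`, `r`, `q`. -/

/-- The finite `x`-Pochhammer symbol `(x; x)_m`. -/
def qPoch (x : ℝ) (m : ℕ) : ℝ := ∏ i ∈ Finset.range m, (1 - x ^ (i + 1))

/-- The Gaussian binomial coefficient, as a function of the real parameter `x`. -/
def gaussBinom (x : ℝ) : ℕ → ℕ → ℝ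
  | _, 0 => 1
  | 0, _ + 1 => 0
  | n + 1, k + 1 => gaussBinom x n k + x ^ (k + 1) * gaussBinom x n (k + 1)

/-! ### Finite Pochhammer symbols and Gaussian binomials. -/

section QSeries

variable {x : ℝ}

@[simp] lemma qPoch_zero : qPoch x 0 = 1 := rfl

lemma qPoch_succ (m : ℕ) : qPoch x (m + 1) = qPoch x m * (1 - x ^ (m + 1)) := by
  simp [qPoch, Finset.prod_range_succ]

lemma qPoch_pos (h0 : 0 ≤ x) (h1 : x < 1) (m : ℕ) : 0 < qPoch x m :=
  Finset.prod_pos fun i _ => by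
    have := pow_lt_one₀ h0 h1 (Nat.succ_ne_zero i)
    simp only [Nat.succ_eq_add_one] at this
    linarith

lemma qPoch_add (a b : ℕ) :
    qPoch x (a + b) = qPoch x a * ∏ i ∈ Finset.range b, (1 - x ^ (a + i + 1)) := by
  simp [qPoch, Finset.prod_range_add]

lemma qPoch_antitone (h0 : 0 ≤ x) (h1 : x < 1) : Antitone (qPoch x) := by
  refine antitone_nat_of_succ_le fun m => ?_
  rw [qPoch_succ]
  have := qPoch_pos h0 h1 m
  have h : 0 ≤ x ^ (m + 1) := by positivity
  nlinarith

lemma qPoch_mul_le_qPoch_add (h0 : 0 ≤ x) (h1 : x < 1) (a b : ℕ) :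
    qPoch x a * qPoch x b ≤ qPoch x (a + b) := by
  rw [qPoch_add]
  refine mul_le_mul_of_nonneg_left ?_ (qPoch_pos h0 h1 a).le
  refine Finset.prod_le_prod (fun i _ => ?_) fun i _ => ?_
  · have := pow_le_one₀ h0 h1.le (n := i + 1)
    linarith
  · have := pow_le_pow_of_le_one h0 h1.le (show i + 1 ≤ a + i + 1 by omega)
    linarith

lemma pow_le_qPoch (h0 : 0 ≤ x) (h1 : x ≤ 1 / 2) (m : ℕ) : x ^ m ≤ qPoch x m := by
  rw [qPoch, ← Finset.card_range m, ← Finset.prod_const, Finset.card_range]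
  refine Finset.prod_le_prod (fun _ _ => h0) fun i _ => ?_
  have := pow_le_of_le_one h0 (h1.trans (by norm_num)) (Nat.succ_ne_zero i)
  simp only [Nat.succ_eq_add_one] at this
  linarith

lemma one_sub_two_mul_le_qPoch (h0 : 0 ≤ x) (h1 : x ≤ 1 / 2) (m : ℕ) :
    1 - 2 * x ≤ qPoch x m := by
  -- The surplus `2 * x ^ (m + 1)` pays for the next factor `1 - x ^ (m + 1)`.
  have key : ∀ m : ℕ, 1 - 2 * x + 2 * x ^ (m + 1) ≤ qPoch x m := by
    intro m
    induction m with
    | zero => simp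
    | succ m ih =>
      rw [qPoch_succ]
      have hp : x ^ (m + 1) ≤ 1 := pow_le_one₀ h0 (h1.trans (by norm_num))
      have h2 : (0 : ℝ) ≤ x ^ (m + 1) := by positivity
      have h3 : (1 - 2 * x + 2 * x ^ (m + 1)) * (1 - x ^ (m + 1)) ≤
          qPoch x m * (1 - x ^ (m + 1)) := mul_le_mul_of_nonneg_right ih (by linarith)
      refine le_trans ?_ h3
      have h4 : x ^ (m + 1) ≤ x := by
        simpa using pow_le_of_le_one h0 (h1.trans (by norm_num)) (Nat.succ_ne_zero m)
      rw [pow_succ x (m + 1)]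
      nlinarith
  have := key m
  have h2 : (0 : ℝ) ≤ x ^ (m + 1) := by positivity
  linarith

/-- The bound comes from the start `1 - x - x²` of Euler's pentagonal series, which is at least
`1/4` on `[0, 1/2]`. It serves only to bound `splitSum` uniformly. -/
lemma quarter_le_qPoch (h0 : 0 ≤ x) (h1 : x ≤ 1 / 2) (m : ℕ) : 1 / 4 ≤ qPoch x m := by
  have key : ∀ m : ℕ, 1 - x - x ^ 2 + x ^ (m + 2) ≤ qPoch x (m + 1) := by
    intro m
    induction m with
    | zero => simp [qPoch]
    | succ m ih =>
      rw [qPoch_succ]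
      have hp : x ^ (m + 2) ≤ 1 := pow_le_one₀ h0 (h1.trans (by norm_num))
      have h2 : (0 : ℝ) ≤ x ^ (m + 2) := by positivity
      have h3 := mul_le_mul_of_nonneg_right ih (show 0 ≤ 1 - x ^ (m + 2) by linarith)
      refine le_trans ?_ h3
      have h4 : x ^ (m + 2) ≤ x ^ 2 :=
        pow_le_pow_of_le_one h0 (h1.trans (by norm_num)) (by omega)
      have h5 : x ^ (m + 1 + 2) = x ^ (m + 2) * x := by ring
      rw [h5]
      nlinarith
  have h2 : (0 : ℝ) ≤ x ^ (m + 2) := by positivity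
  have h3 := qPoch_antitone h0 (by linarith) (Nat.le_succ m)
  have h4 := key m
  simp only [Nat.succ_eq_add_one] at h3
  nlinarith

/-- Telescoping: `x^m / (x;x)_m = 1/(x;x)_m - 1/(x;x)_{m-1}`. -/
lemma sum_pow_div_qPoch (h0 : 0 ≤ x) (h1 : x < 1) (L : ℕ) :
    ∑ m ∈ Finset.range (L + 1), x ^ m / qPoch x m = 1 / qPoch x L := by
  induction L with
  | zero => simp
  | succ L ih =>
    rw [Finset.sum_range_succ, ih, qPoch_succ]
    have hL := (qPoch_pos h0 h1 L).ne'
    have hs := (qPoch_pos h0 h1 (L + 1)).ne'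
    rw [qPoch_succ] at hs
    have := right_ne_zero_of_mul hs
    field_simp
    ring

@[simp] lemma gaussBinom_zero_right (n : ℕ) : gaussBinom x n 0 = 1 := by
  cases n <;> rfl

lemma gaussBinom_zero_succ (k : ℕ) : gaussBinom x 0 (k + 1) = 0 := rfl

lemma gaussBinom_succ_succ (n k : ℕ) : gaussBinom x (n + 1) (k + 1) =
    gaussBinom x n k + x ^ (k + 1) * gaussBinom x n (k + 1) := rfl

lemma gaussBinom_eq_zero {n k : ℕ} (h : n < k) : gaussBinom x n k = 0 := by
  induction n generalizing k with
  | zero => obtain ⟨k, rfl⟩ := Nat.exists_eq_succ_of_ne_zero h.ne'; rfl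
  | succ n ih =>
    obtain ⟨k, rfl⟩ := Nat.exists_eq_succ_of_ne_zero (Nat.ne_zero_of_lt h)
    rw [gaussBinom_succ_succ, ih (by omega), ih (by omega)]
    ring

lemma gaussBinom_self (n : ℕ) : gaussBinom x n n = 1 := by
  induction n with
  | zero => rfl
  | succ n ih => rw [gaussBinom_succ_succ, ih, gaussBinom_eq_zero n.lt_succ_self]; ring

lemma gaussBinom_mul_qPoch_mul_qPoch (a b : ℕ) :
    gaussBinom x (a + b) a * qPoch x a * qPoch x b = qPoch x (a + b) := by
  induction hN : a + b generalizing a b with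
  | zero =>
    obtain ⟨rfl, rfl⟩ := Nat.add_eq_zero_iff.mp hN
    simp
  | succ N ih =>
    cases a with
    | zero => simp at hN; subst hN; simp
    | succ a =>
      have h1 := ih a b (by omega)
      cases b with
      | zero =>
        have : N = a := by omega
        subst this
        rw [gaussBinom_self]; simp
      | succ b =>
        have h2 := ih (a + 1) b (by omega)
        have hN' : N = a + b + 1 := by omega
        rw [gaussBinom_succ_succ, qPoch_succ N, add_mul, add_mul]
        have e1 : gaussBinom x N a * qPoch x (a + 1) * qPoch x (b + 1) =
            qPoch x N * (1 - x ^ (a + 1)) := by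
          rw [← h1, qPoch_succ a]; ring
        have e2 : x ^ (a + 1) * gaussBinom x N (a + 1) * qPoch x (a + 1) * qPoch x (b + 1) =
            qPoch x N * (x ^ (a + 1) * (1 - x ^ (b + 1))) := by
          rw [← h2, qPoch_succ b]; ring
        rw [e1, e2, hN']
        ring

/-- The `q`-Vandermonde identity. The truncation in `M - p.1` is harmless, as `gaussBinom x M p.1`
vanishes for `p.1 > M`. -/
lemma gaussBinom_add (M N K : ℕ) : gaussBinom x (M + N) K =
    ∑ p ∈ Finset.HasAntidiagonal.antidiagonal K,
      x ^ ((M - p.1) * p.2) * gaussBinom x M p.1 * gaussBinom x N p.2 := by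
  induction M generalizing K with
  | zero =>
    cases K with
    | zero => simp
    | succ K => rw [Finset.Nat.sum_antidiagonal_succ]; simp [gaussBinom_zero_succ]
  | succ M ih =>
    cases K with
    | zero => simp
    | succ K =>
      rw [show M + 1 + N = M + N + 1 by ring, gaussBinom_succ_succ, ih, ih,
        Finset.Nat.sum_antidiagonal_succ, Finset.Nat.sum_antidiagonal_succ, mul_add,
        Finset.mul_sum]
      rw [add_left_comm, ← Finset.sum_add_distrib]
      congr 1
      · simp only [gaussBinom_zero_right, Nat.sub_zero]
        ring
      · refine Finset.sum_congr rfl fun p hp => ?_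
        have hK : p.1 + p.2 = K := Finset.HasAntidiagonal.mem_antidiagonal.mp hp
        rw [gaussBinom_succ_succ, show M + 1 - (p.1 + 1) = M - p.1 by omega]
        by_cases h : p.1 + 1 ≤ M
        · obtain ⟨c, rfl⟩ := Nat.exists_eq_add_of_le h
          rw [show p.1 + 1 + c - p.1 = c + 1 by omega,
            show p.1 + 1 + c - (p.1 + 1) = c by omega, ← hK]
          ring
        · rw [gaussBinom_eq_zero (show M < p.1 + 1 by omega)]
          ring

end QSeries

/-! ### Weighted sums over nondecreasing chains. -/

open Finset.HasAntidiagonal in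
lemma sum_antidiagonal_snd_antidiagonal_comm {M : Type*} [AddCommMonoid M] (f : ℕ → ℕ → ℕ → M)
    (n : ℕ) :
    ∑ p ∈ antidiagonal n, ∑ r ∈ antidiagonal p.2, f p.1 r.1 r.2 =
      ∑ p ∈ antidiagonal n, ∑ r ∈ antidiagonal p.2, f r.1 p.1 r.2 := by
  rw [Finset.sum_sigma', Finset.sum_sigma']
  refine Finset.sum_nbij' (fun z => ⟨(z.2.1, z.1.1 + z.2.2), (z.1.1, z.2.2)⟩)
    (fun z => ⟨(z.2.1, z.1.1 + z.2.2), (z.1.1, z.2.2)⟩) ?_ ?_ ?_ ?_ ?_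
  · rintro ⟨⟨a, b⟩, ⟨c, d⟩⟩ h
    obtain ⟨h1, h2⟩ := Finset.mem_sigma.mp h
    rw [mem_antidiagonal] at h1 h2
    dsimp only at h1 h2
    refine Finset.mem_sigma.mpr ⟨mem_antidiagonal.mpr ?_, mem_antidiagonal.mpr rfl⟩
    dsimp only
    omega
  · rintro ⟨⟨a, b⟩, ⟨c, d⟩⟩ h
    obtain ⟨h1, h2⟩ := Finset.mem_sigma.mp h
    rw [mem_antidiagonal] at h1 h2
    dsimp only at h1 h2
    refine Finset.mem_sigma.mpr ⟨mem_antidiagonal.mpr ?_, mem_antidiagonal.mpr rfl⟩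
    dsimp only
    omega
  · rintro ⟨⟨a, b⟩, ⟨c, d⟩⟩ h
    simp only [Finset.mem_sigma, mem_antidiagonal] at h ⊢
    obtain ⟨h1, rfl⟩ := h
    rfl
  · rintro ⟨⟨a, b⟩, ⟨c, d⟩⟩ h
    simp only [Finset.mem_sigma, mem_antidiagonal] at h ⊢
    obtain ⟨h1, rfl⟩ := h
    rfl
  · rintro ⟨⟨a, b⟩, ⟨c, d⟩⟩ h
    rfl

/-- The weight `1 / (x; x)_{b - a}` of a step from `a` up to `b`. -/
noncomputable def stepWeight (x : ℝ) (a b : ℕ) : ℝ :=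
  if a ≤ b then 1 / qPoch x (b - a) else 0

/-- The sum over all chains `a ≤ m₁ ≤ ⋯ ≤ m_t ≤ b` with `m₁ + ⋯ + m_t = ℓ` of the product of the
weights `v m_i` and of the weights of the `t + 1` steps. -/
noncomputable def chainSum (x : ℝ) (v : ℕ → ℝ) : ℕ → ℕ → ℕ → ℕ → ℝ
  | 0, a, b, ℓ => if ℓ = 0 then stepWeight x a b else 0
  | t + 1, a, b, ℓ => ∑ p ∈ Finset.HasAntidiagonal.antidiagonal ℓ,
      stepWeight x a p.1 * v p.1 * chainSum x v t p.1 b p.2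

section ChainSum

variable {x : ℝ} {v : ℕ → ℝ}

open Finset.HasAntidiagonal

lemma stepWeight_nonneg (h0 : 0 ≤ x) (h1 : x < 1) (a b : ℕ) : 0 ≤ stepWeight x a b := by
  unfold stepWeight
  split_ifs
  · exact (one_div_pos.mpr (qPoch_pos h0 h1 _)).le
  · exact le_rfl

@[simp] lemma stepWeight_self (a : ℕ) : stepWeight x a a = 1 := by simp [stepWeight]

lemma stepWeight_of_lt {a b : ℕ} (h : b < a) : stepWeight x a b = 0 :=
  if_neg (not_le.mpr h)

lemma stepWeight_zero_left (b : ℕ) : stepWeight x 0 b = 1 / qPoch x b := by simp [stepWeight]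

lemma stepWeight_add_add (k a b : ℕ) : stepWeight x (k + a) (k + b) = stepWeight x a b := by
  unfold stepWeight
  simp only [add_le_add_iff_left, Nat.add_sub_add_left]

lemma stepWeight_sub_sub {k d b : ℕ} (hd : d ≤ k) (hb : b ≤ k) :
    stepWeight x (k - b) (k - d) = stepWeight x d b := by
  unfold stepWeight
  by_cases h : d ≤ b
  · rw [if_pos h, if_pos (by omega), show k - d - (k - b) = b - d by omega]
  · rw [if_neg h, if_neg (by omega)]

lemma chainSum_zero (a b ℓ : ℕ) :
    chainSum x v 0 a b ℓ = if ℓ = 0 then stepWeight x a b else 0 := rfl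

lemma chainSum_succ (t a b ℓ : ℕ) : chainSum x v (t + 1) a b ℓ =
    ∑ p ∈ antidiagonal ℓ, stepWeight x a p.1 * v p.1 * chainSum x v t p.1 b p.2 := rfl

/-- Peels off the last entry instead of the first: the Hall recursion runs over the largest entry.
-/
lemma chainSum_succ_right (t a b ℓ : ℕ) : chainSum x v (t + 1) a b ℓ =
    ∑ p ∈ antidiagonal ℓ, chainSum x v t a p.1 p.2 * v p.1 * stepWeight x p.1 b := by
  induction t generalizing a ℓ with
  | zero =>
    rw [chainSum_succ]
    refine Finset.sum_congr rfl fun p _ => ?_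
    rw [chainSum_zero, chainSum_zero]
    split_ifs <;> ring
  | succ t ih =>
    rw [chainSum_succ]
    simp_rw [ih, chainSum_succ t, Finset.mul_sum, Finset.sum_mul]
    rw [sum_antidiagonal_snd_antidiagonal_comm (fun i j l => stepWeight x a i * v i *
      (chainSum x v t i j l * v j * stepWeight x j b))]
    refine Finset.sum_congr rfl fun p _ => Finset.sum_congr rfl fun r _ => ?_
    ring

lemma chainSum_nonneg (h0 : 0 ≤ x) (h1 : x < 1) (hv : ∀ m, 0 ≤ v m) (t a b ℓ : ℕ) :
    0 ≤ chainSum x v t a b ℓ := by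
  induction t generalizing a ℓ with
  | zero =>
    rw [chainSum_zero]
    split_ifs
    · exact stepWeight_nonneg h0 h1 _ _
    · exact le_rfl
  | succ t ih =>
    exact Finset.sum_nonneg fun p _ =>
      mul_nonneg (mul_nonneg (stepWeight_nonneg h0 h1 _ _) (hv _)) (ih _ _)

lemma chainSum_eq_zero_of_lt_mul {t a b ℓ : ℕ} (h : ℓ < t * a) : chainSum x v t a b ℓ = 0 := by
  induction t generalizing a ℓ with
  | zero => simp at h
  | succ t ih =>
    refine Finset.sum_eq_zero fun p hp => ?_
    rw [mem_antidiagonal] at hp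
    rcases lt_or_ge p.1 a with h' | h'
    · rw [stepWeight_of_lt h']; ring
    · rw [ih (by nlinarith), mul_zero]

lemma chainSum_eq_zero_of_right_lt {t a b ℓ : ℕ} (h : b < a) : chainSum x v t a b ℓ = 0 := by
  induction t generalizing a ℓ with
  | zero => rw [chainSum_zero, stepWeight_of_lt h, ite_self]
  | succ t ih =>
    refine Finset.sum_eq_zero fun p hp => ?_
    rcases lt_or_ge p.1 a with h' | h'
    · rw [stepWeight_of_lt h']; ring
    · rw [ih (by omega), mul_zero]

lemma chainSum_eq_zero_of_mul_lt {t a b ℓ : ℕ} (h : t * b < ℓ) : chainSum x v t a b ℓ = 0 := by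
  induction t generalizing a ℓ with
  | zero => rw [chainSum_zero, if_neg (by omega)]
  | succ t ih =>
    refine Finset.sum_eq_zero fun p hp => ?_
    rw [mem_antidiagonal] at hp
    rcases lt_or_ge b p.1 with h' | h'
    · rw [chainSum_eq_zero_of_right_lt h', mul_zero]
    · rw [ih (by nlinarith), mul_zero]

lemma chainSum_scale {v' : ℕ → ℝ} {c z : ℝ} (hv : ∀ m, v' m = c * z ^ m * v m) (t a b ℓ : ℕ) :
    chainSum x v' t a b ℓ = c ^ t * z ^ ℓ * chainSum x v t a b ℓ := by
  induction t generalizing a ℓ with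
  | zero =>
    rw [chainSum_zero, chainSum_zero]
    split_ifs with h
    · simp [h]
    · simp
  | succ t ih =>
    rw [chainSum_succ, chainSum_succ, Finset.mul_sum]
    refine Finset.sum_congr rfl fun p hp => ?_
    rw [mem_antidiagonal] at hp
    rw [ih, hv, ← hp]
    ring

lemma sum_antidiagonal_eq_sum_range (f : ℕ → ℕ → ℝ) (n : ℕ) :
    ∑ p ∈ antidiagonal n, f p.1 p.2 = ∑ m ∈ Finset.range (n + 1), f m (n - m) :=
  Finset.Nat.sum_antidiagonal_eq_sum_range_succ f n

lemma chainSum_shift (k t a b e : ℕ) :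
    chainSum x v t (k + a) (k + b) (t * k + e) = chainSum x (fun d => v (k + d)) t a b e := by
  induction t generalizing a e with
  | zero => simp only [chainSum_zero, stepWeight_add_add]; simp
  | succ t ih =>
    rw [chainSum_succ, chainSum_succ]
    rw [sum_antidiagonal_eq_sum_range
        (fun m l => stepWeight x (k + a) m * v m * chainSum x v t m (k + b) l),
      sum_antidiagonal_eq_sum_range
        (fun m l => stepWeight x a m * v (k + m) * chainSum x (fun d => v (k + d)) t m b l)]
    -- Two blocks of the range vanish: first entries below `k`, which lie under the start `k + a`,
    -- and first entries so large that the `t` later ones would exceed the remaining total.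
    rw [show (t + 1) * k + e + 1 = k + ((e + 1) + t * k) by ring, Finset.sum_range_add,
      Finset.sum_eq_zero, zero_add, Finset.sum_range_add, Finset.sum_eq_zero (s := .range (t * k)),
      add_zero]
    · refine Finset.sum_congr rfl fun m hm => ?_
      have hm : m ≤ e := by simpa [Nat.lt_succ_iff] using hm
      rw [stepWeight_add_add, show (t + 1) * k + e - (k + m) = t * k + (e - m) by
        rw [add_mul, one_mul]; omega, ih]
    · intro m hm
      rw [chainSum_eq_zero_of_lt_mul, mul_zero]
      have hm : m < t * k := by simpa using hm
      have h2 : t * (k + (e + 1 + m)) = t * k + t * (e + 1 + m) := by ring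
      have h3 : (t + 1) * k = t * k + k := by ring
      have ht : t ≠ 0 := by rintro rfl; simp at hm
      have h4 := Nat.pos_of_ne_zero ht
      omega
    · intro m hm
      rw [stepWeight_of_lt (by have := Finset.mem_range.mp hm; omega)]
      ring

lemma chainSum_bot_right_zero (t b : ℕ) (hv : v 0 = 1) :
    chainSum x v t 0 b 0 = stepWeight x 0 b := by
  induction t with
  | zero => simp [chainSum_zero]
  | succ t ih => simp [chainSum_succ, ih, hv]

end ChainSum

/-! ### Hall-type sums in closed form. -/

/-- The sum of all chain weights with `v d = x ^ d ^ 2`, over all lengths of chains of positive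
numbers; see `sum_chainSum_le_hallSum`. -/
noncomputable def hallSum (x : ℝ) (b m : ℕ) : ℝ :=
  x ^ m * gaussBinom x (b + m - 1) m / qPoch x b

/-- The weight `x ^ d ^ 2` of positive numbers `d`, and `0` at `0`. -/
noncomputable def posSqWeight (x : ℝ) (d : ℕ) : ℝ := if d = 0 then 0 else x ^ d ^ 2

section Hall

variable {x : ℝ}

open Finset.HasAntidiagonal

lemma posSqWeight_nonneg (h0 : 0 ≤ x) (d : ℕ) : 0 ≤ posSqWeight x d := by
  unfold posSqWeight; positivity

lemma hallSum_zero_right (b : ℕ) : hallSum x b 0 = stepWeight x 0 b := by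
  simp [hallSum, stepWeight]

lemma hallSum_zero_succ (m : ℕ) : hallSum x 0 (m + 1) = 0 := by
  simp [hallSum, gaussBinom_eq_zero m.lt_succ_self]

/-- This is `q`-Vandermonde with `d = p.1` as the largest entry: `m - j = d - 1`, and `x^(m+1)
x^((d-1)d) = x^j x^(d²)`. -/
lemma hallSum_succ (h0 : 0 ≤ x) (h1 : x < 1) (b m : ℕ) : hallSum x b (m + 1) =
    ∑ p ∈ antidiagonal (m + 1), hallSum x p.1 p.2 * posSqWeight x p.1 * stepWeight x p.1 b := by
  rw [hallSum, show b + (m + 1) - 1 = m + b by omega, gaussBinom_add, Finset.mul_sum,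
    Finset.sum_div]
  rw [← Finset.Nat.sum_antidiagonal_swap]
  refine Finset.sum_congr rfl fun p hp => ?_
  rw [mem_antidiagonal] at hp
  obtain ⟨d, j⟩ := p
  simp only [Prod.fst_swap, Prod.snd_swap] at hp ⊢
  cases d with
  | zero =>
    rw [gaussBinom_eq_zero (show m < j by omega)]
    simp [posSqWeight]
  | succ d =>
    rw [posSqWeight, if_neg d.succ_ne_zero, hallSum, stepWeight]
    have hj : d + 1 + j - 1 = m := by omega
    rw [hj, show m - j = d by omega]
    split_ifs with h
    · obtain ⟨c, rfl⟩ := Nat.exists_eq_add_of_le h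
      have e := gaussBinom_mul_qPoch_mul_qPoch (x := x) (d + 1) c
      rw [← e, Nat.add_sub_cancel_left, ← hp]
      have h1' := (qPoch_pos h0 h1 (d + 1)).ne'
      have h2' := (qPoch_pos h0 h1 c).ne'
      have h3' := (qPoch_pos h0 h1 (d + 1 + c)).ne'
      rw [← e] at h3'
      have h4' : gaussBinom x (d + 1 + c) (d + 1) ≠ 0 := fun h => h3' (by rw [h]; ring)
      field_simp
      ring
    · rw [gaussBinom_eq_zero (show b < d + 1 by omega)]
      simp

lemma hallSum_nonneg (h0 : 0 ≤ x) (b m : ℕ) (h1 : x < 1) : 0 ≤ hallSum x b m := by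
  have hg : ∀ n k, 0 ≤ gaussBinom x n k := by
    intro n
    induction n with
    | zero => intro k; cases k <;> simp [gaussBinom_zero_succ]
    | succ n ih =>
      intro k
      cases k with
      | zero => simp
      | succ k => exact add_nonneg (ih _) (mul_nonneg (by positivity) (ih _))
  exact div_nonneg (mul_nonneg (by positivity) (hg _ _)) (qPoch_pos h0 h1 _).le

lemma hallSum_le (h0 : 0 ≤ x) (h1 : x < 1) (b m : ℕ) :
    hallSum x b m ≤ x ^ m / qPoch x m / qPoch x b := by
  have hb := qPoch_pos h0 h1 b
  have hm := qPoch_pos h0 h1 m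
  cases b with
  | zero =>
    cases m with
    | zero => simp [hallSum]
    | succ m => rw [hallSum_zero_succ]; positivity
  | succ b =>
    rw [hallSum, show b + 1 + m - 1 = m + b by omega]
    refine div_le_div_of_nonneg_right ?_ hb.le
    rw [div_eq_mul_one_div]
    refine mul_le_mul_of_nonneg_left ?_ (by positivity)
    rw [le_div_iff₀ hm]
    have e := gaussBinom_mul_qPoch_mul_qPoch (x := x) m b
    have hb' := qPoch_pos h0 h1 b
    have h2 := qPoch_antitone h0 h1 (show b ≤ m + b by omega)
    rw [← e] at h2
    exact le_of_mul_le_mul_right (by rwa [one_mul]) hb'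

/-- A chain of naturals is a chain of positive numbers preceded by zeros of weight 1, so fixing the
length `t` selects some of the positive chains that `hallSum` accounts for. -/
lemma chainSum_le_hallSum (h0 : 0 ≤ x) (h1 : x < 1) (t b m : ℕ) :
    chainSum x (fun d => x ^ d ^ 2) t 0 b m ≤ hallSum x b m := by
  induction t generalizing b m with
  | zero =>
    rw [chainSum_zero]
    split_ifs with h
    · rw [h, hallSum_zero_right]
    · exact hallSum_nonneg h0 b m h1
  | succ t ih =>
    cases m with
    | zero => rw [chainSum_bot_right_zero _ _ (by simp), hallSum_zero_right]
    | succ m =>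
      rw [chainSum_succ_right, hallSum_succ h0 h1]
      refine Finset.sum_le_sum fun p hp => ?_
      rw [mem_antidiagonal] at hp
      refine mul_le_mul_of_nonneg_right ?_ (stepWeight_nonneg h0 h1 _ _)
      unfold posSqWeight
      split_ifs with h
      -- A last entry 0 would leave the positive total `m + 1` to entries bounded by 0.
      · rw [h] at hp ⊢
        refine le_of_eq_of_le ?_ (mul_zero (hallSum x 0 p.2)).ge
        have := ih 0 p.2
        rw [show p.2 = m + 1 by omega, hallSum_zero_succ] at this
        rw [show p.2 = m + 1 by omega, le_antisymm this
          (chainSum_nonneg h0 h1 (fun d => by positivity) _ _ _ _), zero_mul]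
      · exact mul_le_mul_of_nonneg_right (ih _ _) (by positivity)

lemma sum_chainSum_le_hallSum (h0 : 0 ≤ x) (h1 : x < 1) (t b m : ℕ) :
    ∑ j ∈ Finset.range (t + 1), chainSum x (posSqWeight x) j 0 b m ≤ hallSum x b m := by
  induction t generalizing b m with
  | zero =>
    simp only [zero_add, Finset.sum_range_one, chainSum_zero]
    split_ifs with h
    · rw [h, hallSum_zero_right]
    · exact hallSum_nonneg h0 b m h1
  | succ t ih =>
    rw [Finset.sum_range_succ', chainSum_zero]
    simp_rw [chainSum_succ_right]
    cases m with
    | zero => simp [hallSum_zero_right, posSqWeight]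
    | succ m =>
      rw [if_neg m.succ_ne_zero, add_zero, Finset.sum_comm, hallSum_succ h0 h1]
      refine Finset.sum_le_sum fun p _ => ?_
      rw [← Finset.sum_mul, ← Finset.sum_mul]
      exact mul_le_mul_of_nonneg_right (mul_le_mul_of_nonneg_right (ih _ _)
        (posSqWeight_nonneg h0 _)) (stepWeight_nonneg h0 h1 _ _)

end Hall

/-! ### Cutting chains at `k` into two independent halves. -/

/-- The weight `x ^ (m - k) ^ 2`. -/
noncomputable def centeredWeight (x : ℝ) (k m : ℕ) : ℝ := x ^ ((m : ℤ) - k).natAbs ^ 2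

/-- The sum of the weights of chains of `j` positive numbers with sum `E - e`, if `e ≤ E`. -/
noncomputable def posChainSum (x : ℝ) (j b e E : ℕ) : ℝ :=
  if e ≤ E then chainSum x (posSqWeight x) j 0 b (E - e) else 0

/-- The sum of the weights of pairs of chains, the first of `j ≤ t` positive numbers
and with sum `E - e`, the second of `t - j` natural numbers and with sum `E < L`. -/
noncomputable def splitSum (x : ℝ) (r L t b e : ℕ) : ℝ :=
  ∑ j ∈ Finset.range (t + 1), ∑ E ∈ Finset.range L,
    posChainSum x j b e E * chainSum x (fun d => x ^ d ^ 2) (t - j) 0 r E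

section Split

variable {x : ℝ}

open Finset.HasAntidiagonal

lemma centeredWeight_nonneg (h0 : 0 ≤ x) (k m : ℕ) : 0 ≤ centeredWeight x k m :=
  pow_nonneg h0 _

lemma centeredWeight_add (k d : ℕ) : centeredWeight x k (k + d) = x ^ d ^ 2 := by
  rw [centeredWeight]
  congr 2
  omega

lemma centeredWeight_sub {k d : ℕ} (h : d ≤ k) : centeredWeight x k (k - d) = x ^ d ^ 2 := by
  rw [centeredWeight]
  congr 2
  omega

lemma chainSum_centeredWeight_shift (k t a b e : ℕ) :
    chainSum x (centeredWeight x k) t (k + a) (k + b) (t * k + e) =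
      chainSum x (fun d => x ^ d ^ 2) t a b e := by
  rw [chainSum_shift]
  simp_rw [centeredWeight_add]

lemma posChainSum_nonneg (h0 : 0 ≤ x) (h1 : x < 1) (j b e E : ℕ) :
    0 ≤ posChainSum x j b e E := by
  unfold posChainSum
  split_ifs
  · exact chainSum_nonneg h0 h1 (posSqWeight_nonneg h0) _ _ _ _
  · exact le_rfl

lemma posChainSum_zero (b e E : ℕ) :
    posChainSum x 0 b e E = if E = e then stepWeight x 0 b else 0 := by
  rw [posChainSum, chainSum_zero]
  split_ifs <;> first | rfl | omega

lemma posChainSum_succ {j b e E N : ℕ} (hN : b ≤ N) : posChainSum x (j + 1) b e E =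
    ∑ d ∈ Finset.range (N + 1),
      posSqWeight x d * stepWeight x d b * posChainSum x j d (e + d) E := by
  unfold posChainSum
  split_ifs with h
  · rw [chainSum_succ_right, sum_antidiagonal_eq_sum_range
      (fun d m => chainSum x (posSqWeight x) j 0 d m * posSqWeight x d * stepWeight x d b)]
    -- Both sides truncate one sum over a common long range: terms beyond `E - e` fail the
    -- condition, terms beyond `N ≥ b` have step weight 0.
    have h1 : ∀ d ∈ Finset.range (N + 1 + (E - e + 1)),
        (if d ≤ E - e then chainSum x (posSqWeight x) j 0 d (E - e - d) * posSqWeight x d *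
          stepWeight x d b else 0) = posSqWeight x d * stepWeight x d b *
          (if e + d ≤ E then chainSum x (posSqWeight x) j 0 d (E - (e + d)) else 0) := by
      intro d _
      by_cases hd : d ≤ E - e
      · rw [if_pos hd, if_pos (by omega), Nat.sub_sub]; ring
      · rw [if_neg hd, if_neg (by omega), mul_zero]
    have h2 := Finset.sum_congr rfl h1
    rw [Finset.sum_range_add _ (N + 1) (E - e + 1),
      Finset.sum_range_add (fun d => posSqWeight x d * stepWeight x d b * _)] at h2
    rw [Finset.sum_eq_zero (s := Finset.range (E - e + 1)) (f := fun d => posSqWeight x (N + 1 + d)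
      * stepWeight x (N + 1 + d) b * _), add_zero, ← Finset.sum_range_add _ (N + 1) (E - e + 1),
      add_comm (N + 1), Finset.sum_range_add, Finset.sum_eq_zero (s := Finset.range (N + 1)),
      add_zero] at h2
    · rw [← h2]
      refine Finset.sum_congr rfl fun d hd => ?_
      rw [if_pos (by have := Finset.mem_range.mp hd; omega)]
    · intro d _
      rw [if_neg (by omega)]
    · intro d _
      rw [stepWeight_of_lt (by omega)]
      ring
  · refine (Finset.sum_eq_zero fun d _ => ?_).symm
    rw [if_neg (by omega), mul_zero]

/-- Here `e` is the deviation already spent below `k`. Either another entry `k - d` follows, or (`j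
= 0`) the lower half is finished and the upper half must have total exactly `e`. -/
lemma splitSum_succ {r L t b e N : ℕ} (hN : b ≤ N) : splitSum x r L (t + 1) b e =
    ∑ d ∈ Finset.range (N + 1), posSqWeight x d * stepWeight x d b * splitSum x r L t d (e + d) +
      if e < L then stepWeight x 0 b * chainSum x (fun d => x ^ d ^ 2) (t + 1) 0 r e else 0 := by
  rw [splitSum, Finset.sum_range_succ']
  congr 1
  · simp_rw [splitSum, Finset.mul_sum]
    conv_rhs => rw [Finset.sum_comm]
    refine Finset.sum_congr rfl fun j _ => ?_
    conv_rhs => rw [Finset.sum_comm]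
    refine Finset.sum_congr rfl fun E _ => ?_
    rw [posChainSum_succ hN, Finset.sum_mul, Nat.add_sub_add_right]
    exact Finset.sum_congr rfl fun d _ => by ring
  · simp only [posChainSum_zero, ite_mul, zero_mul, Finset.sum_ite_eq', Finset.mem_range,
      Nat.sub_zero]

lemma splitSum_zero (r L b e : ℕ) : splitSum x r L 0 b e =
    if e < L then stepWeight x 0 b * chainSum x (fun d => x ^ d ^ 2) 0 0 r e else 0 := by
  simp [splitSum, posChainSum_zero]

lemma chainSum_centeredWeight_succ {k b : ℕ} (hb : b ≤ k) (r t e : ℕ) :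
    chainSum x (centeredWeight x k) (t + 1) (k - b) (k + r) ((t + 1) * k + e) =
      ∑ d ∈ Finset.range (k + 1), posSqWeight x d * stepWeight x d b *
          chainSum x (centeredWeight x k) t (k - d) (k + r) (t * k + (e + d)) +
        ∑ d ∈ Finset.range (t * k + e + 1), stepWeight x (k - b) (k + d) * x ^ d ^ 2 *
          chainSum x (centeredWeight x k) t (k + d) (k + r) (t * k + e - d) := by
  rw [chainSum_succ, sum_antidiagonal_eq_sum_range (fun m l => stepWeight x (k - b) m *
      centeredWeight x k m * chainSum x (centeredWeight x k) t m (k + r) l),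
    show (t + 1) * k + e + 1 = k + (t * k + e + 1) by ring, Finset.sum_range_add]
  congr 1
  -- The term `d = 0` is void because `posSqWeight x 0 = 0`; an entry equal to `k` belongs to the
  -- second sum.
  · rw [Finset.sum_range_succ', ← Finset.sum_range_reflect, posSqWeight, if_pos rfl, zero_mul,
      zero_mul, add_zero]
    refine Finset.sum_congr rfl fun d hd => ?_
    have hd : d < k := Finset.mem_range.mp hd
    rw [show k - 1 - d = k - (d + 1) by omega, stepWeight_sub_sub hd hb,
      centeredWeight_sub hd, posSqWeight, if_neg d.succ_ne_zero,
      show (t + 1) * k + e - (k - (d + 1)) = t * k + (e + (d + 1)) by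
        rw [add_mul, one_mul]; omega]
    simp only [Nat.succ_eq_add_one]
    ring
  · refine Finset.sum_congr rfl fun d _ => ?_
    rw [centeredWeight_add, show (t + 1) * k + e - (k + d) = t * k + e - d by
      rw [add_mul, one_mul]; omega]

lemma stepWeight_sub_add_le (h0 : 0 ≤ x) (h1 : x < 1) {k b : ℕ} (hb : b ≤ k) (d : ℕ) :
    stepWeight x (k - b) (k + d) ≤ stepWeight x 0 b * stepWeight x k (k + d) := by
  unfold stepWeight
  rw [if_pos (by omega), if_pos (by omega), if_pos (by omega), Nat.sub_zero,
    Nat.add_sub_cancel_left, show k + d - (k - b) = b + d by omega, one_div_mul_one_div]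
  exact one_div_le_one_div_of_le (mul_pos (qPoch_pos h0 h1 _) (qPoch_pos h0 h1 _))
    (qPoch_mul_le_qPoch_add h0 h1 b d)

lemma chainSum_centeredWeight_le_splitSum (h0 : 0 ≤ x) (h1 : x < 1) {k r L s t b e : ℕ}
    (hb : b ≤ k) (hL : r * s < L) (ht : t ≤ s) :
    chainSum x (centeredWeight x k) t (k - b) (k + r) (t * k + e) ≤ splitSum x r L t b e := by
  induction t generalizing b e with
  | zero =>
    rw [splitSum_zero, chainSum_zero, chainSum_zero]
    by_cases he : e = 0
    · have := stepWeight_sub_add_le h0 h1 hb r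
      rw [← add_zero k, add_assoc, zero_add, stepWeight_add_add, add_zero] at this
      rw [if_pos (by omega), if_pos (by omega), if_pos he]
      exact this
    · rw [if_neg (by omega), if_neg he, mul_zero, ite_self]
  | succ t ih =>
    rw [chainSum_centeredWeight_succ hb, splitSum_succ hb]
    refine add_le_add ?_ ?_
    · refine Finset.sum_le_sum fun d hd => ?_
      have hd : d ≤ k := Nat.lt_succ_iff.mp (Finset.mem_range.mp hd)
      exact mul_le_mul_of_nonneg_left (ih hd (by omega))
        (mul_nonneg (posSqWeight_nonneg h0 _) (stepWeight_nonneg h0 h1 _ _))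
    -- Here the chain crosses `k`; the crossing step is replaced by a step to `k` followed by one
    -- from `k`.
    · have key : ∑ d ∈ Finset.range (t * k + e + 1), stepWeight x (k - b) (k + d) * x ^ d ^ 2 *
          chainSum x (centeredWeight x k) t (k + d) (k + r) (t * k + e - d) ≤
          stepWeight x 0 b * chainSum x (fun d => x ^ d ^ 2) (t + 1) 0 r e := by
        have h2 := chainSum_centeredWeight_succ (x := x) (Nat.zero_le k) r t e
        rw [Nat.sub_zero] at h2
        have h3 := chainSum_centeredWeight_shift (x := x) k (t + 1) 0 r e
        rw [add_zero] at h3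
        rw [← h3, h2, Finset.sum_eq_zero (s := Finset.range (k + 1)), zero_add, Finset.mul_sum]
        · refine Finset.sum_le_sum fun d _ => ?_
          rw [← mul_assoc, ← mul_assoc]
          exact mul_le_mul_of_nonneg_right (mul_le_mul_of_nonneg_right
            (stepWeight_sub_add_le h0 h1 hb d) (by positivity))
            (chainSum_nonneg h0 h1 (centeredWeight_nonneg h0 k) _ _ _ _)
        · intro d _
          unfold posSqWeight
          split_ifs with hd
          · ring
          · rw [stepWeight_of_lt (Nat.pos_of_ne_zero hd)]; ring
      refine key.trans ?_
      split_ifs with he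
      · exact le_rfl
      -- At most `s` entries, each at most `r`, cannot reach a total `e ≥ L > r * s`.
      · rw [chainSum_eq_zero_of_mul_lt, mul_zero]
        nlinarith

/-- Inserting one entry equal to `k` between the halves makes a genuine chain with the same weight,
hence `t + 1`. -/
lemma splitSum_le_chainSum_centeredWeight (h0 : 0 ≤ x) (h1 : x < 1) {k b : ℕ} (r L t e : ℕ)
    (hb : b ≤ k) : splitSum x r L t b e ≤
      chainSum x (centeredWeight x k) (t + 1) (k - b) (k + r) ((t + 1) * k + e) := by
  have rest : ∀ t b e, b ≤ k →
      (if e < L then stepWeight x 0 b * chainSum x (fun d => x ^ d ^ 2) t 0 r e else 0) ≤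
      ∑ d ∈ Finset.range (t * k + e + 1), stepWeight x (k - b) (k + d) * x ^ d ^ 2 *
          chainSum x (centeredWeight x k) t (k + d) (k + r) (t * k + e - d) := by
    intro t b e hb
    have hn : ∀ d, 0 ≤ stepWeight x (k - b) (k + d) * x ^ d ^ 2 *
        chainSum x (centeredWeight x k) t (k + d) (k + r) (t * k + e - d) := fun d =>
      mul_nonneg (mul_nonneg (stepWeight_nonneg h0 h1 _ _) (by positivity))
        (chainSum_nonneg h0 h1 (centeredWeight_nonneg h0 k) _ _ _ _)
    split_ifs
    -- Only the term `d = 0`, the inserted entry `k`, is kept.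
    · refine le_trans (le_of_eq ?_) (Finset.single_le_sum (fun d _ => hn d)
        (Finset.mem_range.mpr (Nat.succ_pos _)))
      have h2 := stepWeight_sub_sub (x := x) (Nat.zero_le k) hb
      rw [Nat.sub_zero] at h2
      simp [h2, ← chainSum_centeredWeight_shift k t 0 r e]
    · exact Finset.sum_nonneg fun d _ => hn d
  induction t generalizing b e with
  | zero =>
    rw [chainSum_centeredWeight_succ hb, splitSum_zero]
    refine (rest 0 b e hb).trans (le_add_of_nonneg_left (Finset.sum_nonneg fun d _ => ?_))
    exact mul_nonneg (mul_nonneg (posSqWeight_nonneg h0 _) (stepWeight_nonneg h0 h1 _ _))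
      (chainSum_nonneg h0 h1 (centeredWeight_nonneg h0 k) _ _ _ _)
  | succ t ih =>
    rw [chainSum_centeredWeight_succ hb, splitSum_succ hb]
    refine add_le_add (Finset.sum_le_sum fun d hd => ?_) (rest (t + 1) b e hb)
    have hd : d ≤ k := Nat.lt_succ_iff.mp (Finset.mem_range.mp hd)
    exact mul_le_mul_of_nonneg_left (ih _ hd)
      (mul_nonneg (posSqWeight_nonneg h0 _) (stepWeight_nonneg h0 h1 _ _))

lemma splitSum_mono (h0 : 0 ≤ x) (h1 : x < 1) {r L L' t t' : ℕ} (hL : L ≤ L') (ht : t ≤ t')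
    (b e : ℕ) : splitSum x r L t b e ≤ splitSum x r L' t' b e := by
  have hY : ∀ t E, 0 ≤ chainSum x (fun d => x ^ d ^ 2) t 0 r E := fun t E =>
    chainSum_nonneg h0 h1 (fun d => by positivity) _ _ _ _
  -- A leading entry 0 lengthens a chain without changing its weight.
  have hmono : ∀ E, Monotone fun t => chainSum x (fun d => x ^ d ^ 2) t 0 r E := by
    intro E
    refine monotone_nat_of_le_succ fun t => ?_
    rw [chainSum_succ]
    refine le_trans (le_of_eq ?_) (Finset.single_le_sum (fun p _ => mul_nonneg (mul_nonneg
      (stepWeight_nonneg h0 h1 _ _) (by positivity)) (chainSum_nonneg h0 h1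
        (fun d => by positivity) _ _ _ _)) (mem_antidiagonal (a := (0, E)).mpr (zero_add E)))
    simp
  unfold splitSum
  refine (Finset.sum_le_sum fun j hj => ?_).trans
    (Finset.sum_le_sum_of_subset_of_nonneg (Finset.range_subset_range.mpr
      (Nat.add_le_add_right ht 1)) fun j _ _ => Finset.sum_nonneg fun E _ =>
        mul_nonneg (posChainSum_nonneg h0 h1 _ _ _ _) (hY _ _))
  refine (Finset.sum_le_sum fun E _ => ?_).trans
    (Finset.sum_le_sum_of_subset_of_nonneg (Finset.range_subset_range.mpr hL) fun E _ _ =>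
        mul_nonneg (posChainSum_nonneg h0 h1 _ _ _ _) (hY _ _))
  exact mul_le_mul_of_nonneg_left (hmono E (by omega)) (posChainSum_nonneg h0 h1 _ _ _ _)

lemma splitSum_le (h0 : 0 ≤ x) (h1 : x ≤ 1 / 2) (r L t b : ℕ) :
    qPoch x b * qPoch x r * splitSum x r (L + 1) t b 0 ≤ 1 / qPoch x L := by
  have h1' : x < 1 := h1.trans_lt (by norm_num)
  have hb := qPoch_pos h0 h1' b
  have hr := qPoch_pos h0 h1' r
  rw [← sum_pow_div_qPoch h0 h1', splitSum, Finset.sum_comm, Finset.mul_sum]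
  refine Finset.sum_le_sum fun E _ => ?_
  have hE := qPoch_pos h0 h1' E
  have hx : 0 ≤ x ^ E / qPoch x E := by positivity
  have hx1 : x ^ E / qPoch x E ≤ 1 := (div_le_one hE).mpr (pow_le_qPoch h0 h1 E)
  have e1 : ∑ j ∈ Finset.range (t + 1), posChainSum x j b 0 E *
      chainSum x (fun d => x ^ d ^ 2) (t - j) 0 r E ≤ hallSum x b E * hallSum x r E := by
    refine (Finset.sum_le_sum fun j _ => mul_le_mul_of_nonneg_left
      (chainSum_le_hallSum h0 h1' _ _ _) (posChainSum_nonneg h0 h1' _ _ _ _)).trans ?_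
    rw [← Finset.sum_mul]
    refine mul_le_mul_of_nonneg_right ?_ (hallSum_nonneg h0 _ _ h1')
    simpa [posChainSum] using sum_chainSum_le_hallSum h0 h1' t b E
  calc _ ≤ qPoch x b * qPoch x r * ((x ^ E / qPoch x E / qPoch x b) *
        (x ^ E / qPoch x E / qPoch x r)) := by
        refine mul_le_mul_of_nonneg_left (e1.trans (mul_le_mul (hallSum_le h0 h1' _ _)
          (hallSum_le h0 h1' _ _) (hallSum_nonneg h0 _ _ h1') (by positivity))) (by positivity)
    _ = (x ^ E / qPoch x E) * (x ^ E / qPoch x E) := by field_simp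
    _ ≤ _ := mul_le_of_le_one_right hx hx1

lemma one_le_splitSum (h0 : 0 ≤ x) (h1 : x < 1) (r L t b : ℕ) :
    1 ≤ qPoch x b * qPoch x r * splitSum x r (L + 1) t b 0 := by
  have hb := qPoch_pos h0 h1 b
  have hr := qPoch_pos h0 h1 r
  have h := splitSum_mono h0 h1 (r := r) (show 0 + 1 ≤ L + 1 by omega) (Nat.zero_le t) b 0
  rw [splitSum_zero, if_pos (by omega), chainSum_bot_right_zero _ _ (by simp),
    stepWeight_zero_left, stepWeight_zero_left] at h
  refine le_trans (le_of_eq ?_) (mul_le_mul_of_nonneg_left h (by positivity))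
  field_simp

end Split

/-! ### Bounds and limit for the density formula. -/

/-- The proportion of free modules among the submodules of length `s * k` of the free module of
rank `k + r` over a finite chain ring of nilpotency index `s` with residue field of order
`1 / x`; see `freeProbability_eq_freeRatio`. -/
noncomputable def freeRatio (x : ℝ) (k r s : ℕ) : ℝ :=
  1 / (qPoch x k * qPoch x r * chainSum x (centeredWeight x k) s 0 (k + r) (s * k))

section FreeRatio

variable {x : ℝ}

lemma eulerFunction_le_qPoch (h0 : 0 ≤ x) (h1 : x < 1) (m : ℕ) : eulerFunction x ≤ qPoch x m := by
  have hs : Summable fun i : ℕ => ‖-x ^ (i + 1)‖ := by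
    simp_rw [norm_neg, norm_pow, Real.norm_of_nonneg h0, pow_succ]
    exact (summable_geometric_of_lt_one h0 h1).mul_right x
  have hm := (multipliable_one_add_of_summable hs).hasProd.tendsto_prod_nat
  have he : (∏' i : ℕ, (1 + -x ^ (i + 1))) = eulerFunction x := by
    simp only [eulerFunction, qPochhammerInf, sub_eq_add_neg, pow_succ']
  rw [he] at hm
  have hm' : Tendsto (qPoch x) atTop (𝓝 (eulerFunction x)) := by
    simp only [← sub_eq_add_neg] at hm
    exact hm
  exact (qPoch_antitone h0 h1).le_of_tendsto hm' m

variable (k r : ℕ)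

lemma chainSum_zero_left_le_splitSum (h0 : 0 ≤ x) (h1 : x < 1) (s : ℕ) :
    chainSum x (centeredWeight x k) s 0 (k + r) (s * k) ≤ splitSum x r (r * s + 1) s k 0 := by
  simpa using chainSum_centeredWeight_le_splitSum h0 h1 (k := k) (r := r) (b := k) (e := 0) le_rfl
    (Nat.lt_succ_self (r * s)) le_rfl

lemma splitSum_le_chainSum_zero_left (h0 : 0 ≤ x) (h1 : x < 1) (s : ℕ) :
    splitSum x r (r * s + 1) s k 0 ≤
      chainSum x (centeredWeight x k) (s + 1) 0 (k + r) ((s + 1) * k) := by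
  simpa using splitSum_le_chainSum_centeredWeight h0 h1 (k := k) (b := k) r (r * s + 1) s 0 le_rfl

lemma exists_qPoch_le_freeRatio (h0 : 0 ≤ x) (h1 : x ≤ 1 / 2) {s : ℕ} (hs : 0 < s) :
    ∃ m, qPoch x m ≤ freeRatio x k r s := by
  have h1' : x < 1 := h1.trans_lt (by norm_num)
  have hp := mul_pos (qPoch_pos h0 h1' k) (qPoch_pos h0 h1' r)
  refine ⟨r * s, ?_⟩
  obtain ⟨s, rfl⟩ := Nat.exists_eq_succ_of_ne_zero hs.ne'
  rw [freeRatio, le_one_div (qPoch_pos h0 h1' _)]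
  · exact (mul_le_mul_of_nonneg_left (chainSum_zero_left_le_splitSum k r h0 h1' _) hp.le).trans
      (splitSum_le h0 h1 r _ _ k)
  · exact (zero_lt_one.trans_le (one_le_splitSum h0 h1' r (r * s) s k)).trans_le
      (mul_le_mul_of_nonneg_left (splitSum_le_chainSum_zero_left k r h0 h1' s) hp.le)

lemma eulerFunction_le_freeRatio (h0 : 0 ≤ x) (h1 : x ≤ 1 / 2) {s : ℕ} (hs : 0 < s) :
    eulerFunction x ≤ freeRatio x k r s := by
  obtain ⟨m, hm⟩ := exists_qPoch_le_freeRatio k r h0 h1 hs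
  exact (eulerFunction_le_qPoch h0 (h1.trans_lt (by norm_num)) m).trans hm

lemma one_sub_two_mul_le_freeRatio (h0 : 0 ≤ x) (h1 : x ≤ 1 / 2) {s : ℕ} (hs : 0 < s) :
    1 - 2 * x ≤ freeRatio x k r s := by
  obtain ⟨m, hm⟩ := exists_qPoch_le_freeRatio k r h0 h1 hs
  exact (one_sub_two_mul_le_qPoch h0 h1 m).trans hm

lemma exists_tendsto_freeRatio (h0 : 0 ≤ x) (h1 : x ≤ 1 / 2) :
    ∃ d, eulerFunction x ≤ d ∧ Tendsto (freeRatio x k r) atTop (𝓝 d) := by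
  have h1' : x < 1 := h1.trans_lt (by norm_num)
  have hp := mul_pos (qPoch_pos h0 h1' k) (qPoch_pos h0 h1' r)
  set c := qPoch x k * qPoch x r with hc
  set a : ℕ → ℝ := fun s => c * splitSum x r (r * s + 1) s k 0 with ha
  have hmono : Monotone a := fun s s' h => mul_le_mul_of_nonneg_left
    (splitSum_mono h0 h1' (Nat.succ_le_succ (Nat.mul_le_mul_left r h)) h k 0) hp.le
  have hbdd : ∀ s, a s ≤ 4 := fun s => (splitSum_le h0 h1 r (r * s) s k).trans (by
    rw [div_le_iff₀ (qPoch_pos h0 h1' _)]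
    linarith [quarter_le_qPoch h0 h1 (r * s)])
  have hlim := tendsto_atTop_ciSup hmono ⟨4, by rintro _ ⟨s, rfl⟩; exact hbdd s⟩
  set A := ⨆ s, a s
  have hA : 1 ≤ A := ge_of_tendsto' hlim fun s => one_le_splitSum h0 h1' r (r * s) s k
  set b : ℕ → ℝ := fun s => c * chainSum x (centeredWeight x k) s 0 (k + r) (s * k) with hb
  have hblim : Tendsto (fun s => b (s + 1)) atTop (𝓝 A) :=
    tendsto_of_tendsto_of_tendsto_of_le_of_le hlim (hlim.comp (tendsto_add_atTop_nat 1))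
      (fun s => mul_le_mul_of_nonneg_left (splitSum_le_chainSum_zero_left k r h0 h1' s) hp.le)
      (fun s => mul_le_mul_of_nonneg_left (chainSum_zero_left_le_splitSum k r h0 h1' (s + 1)) hp.le)
  have hfin : Tendsto (freeRatio x k r) atTop (𝓝 (1 / A)) := by
    refine (tendsto_add_atTop_iff_nat 1).mp ?_
    exact tendsto_const_nhds.div hblim (by linarith)
  refine ⟨1 / A, ?_, hfin⟩
  exact ge_of_tendsto hfin ((eventually_gt_atTop 0).mono fun s hs =>
    eulerFunction_le_freeRatio k r h0 h1 hs)

end FreeRatio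

/-! ### Uniformizers of a finite chain ring. -/

/-- `π` generates the maximal ideal of a finite chain ring with residue field of order `q` and
nilpotency index `s`, and it generates the same ideal from both sides. -/
structure IsUniformizer {R : Type u} [Ring R] (π : R) (q s : ℕ) : Prop where
  finite : Finite R
  isMaximal : (Ideal.span {π}).IsMaximal
  mem_or_isUnit : ∀ r : R, (∃ a, r = a * π) ∨ IsUnit r
  left_of_right : ∀ r : R, ∃ a, π * r = a * π
  right_of_left : ∀ r : R, ∃ a, r * π = π * a
  card_quotient : Nat.card (R ⧸ Ideal.span {π}) = q
  pos : 0 < s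
  pow_eq_zero : π ^ s = 0
  pow_ne_zero : ∀ t < s, π ^ t ≠ 0

section Ring

variable {R : Type u} [Ring R] {π : R} {q s : ℕ}

lemma IsFiniteChainRing.exists_isUniformizer (h : IsFiniteChainRing R q s) :
    ∃ π : R, IsUniformizer π q s := by
  obtain ⟨π, hmax, hq, ⟨hs, hπ⟩, hleast⟩ := h.exists_generator
  have := h.finite
  have hmem : ∀ r : R, r ∈ Ideal.span {π} ↔ ∃ a, r = a * π := fun r => by
    rw [Ideal.mem_span_singleton']
    exact exists_congr fun a => eq_comm
  have hunit : ∀ r : R, r ∉ Ideal.span {π} → IsUnit r := by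
    intro r hr
    have hle : Ideal.span {π} ≤ Ideal.span {r} :=
      (h.left_chain _ _).resolve_right fun hle => hr (hle (Ideal.mem_span_singleton_self r))
    have htop : Ideal.span {r} = ⊤ := by
      by_contra hne
      exact hr (hmax.eq_of_le hne hle ▸ Ideal.mem_span_singleton_self r)
    obtain ⟨a, ha⟩ := Ideal.mem_span_singleton'.mp (htop ▸ Submodule.mem_top : (1 : R) ∈ _)
    exact IsUnit.of_mul_eq_one_right a ha
  have hnot : ∀ r : R, r ∈ Ideal.span {π} → ¬ IsUnit r := fun r hr hu =>
    hmax.ne_top (Ideal.eq_top_of_isUnit_mem _ hr hu)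
  have hcases : ∀ r : R, (∃ a, r = a * π) ∨ IsUnit r := fun r => by
    by_cases hr : r ∈ Ideal.span {π}
    · exact Or.inl ((hmem r).mp hr)
    · exact Or.inr (hunit r hr)
  have hleft : ∀ r : R, ∃ a, π * r = a * π := by
    intro r
    refine (hcases (π * r)).resolve_right fun hu => ?_
    obtain ⟨b, hb⟩ := hu.exists_right_inv
    exact hnot π (Ideal.mem_span_singleton_self π) (IsUnit.of_mul_eq_one (r * b) (by
      rw [← mul_assoc, hb]))
  have hone : ∀ r : R, r ∈ Ideal.span {π} → IsUnit (1 - r) := fun r hr =>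
    hunit _ fun h1 => hnot 1 (by simpa using add_mem h1 hr) isUnit_one
  -- Compare the right ideals of `π` and `r * π`. If `π = r * π * t` with `t` a unit, invert `t`; if
  -- `t` is a left multiple of `π`, then `(1 - r * b * π) * π = 0` with a unit in front, so `π = 0`.
  have hrightunit : ∀ r : R, IsUnit r → ∃ a, r * π = π * a := by
    intro r hr
    rcases h.right_chain (Submodule.span Rᵐᵒᵖ {π}) (Submodule.span Rᵐᵒᵖ {r * π}) with hle | hle
    · obtain ⟨t, ht⟩ := Submodule.mem_span_singleton.mp
        (hle (Submodule.mem_span_singleton_self π))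
      rw [← MulOpposite.op_unop t, op_smul_eq_mul] at ht
      set t' := MulOpposite.unop t
      rcases hcases t' with ⟨a, ha⟩ | hu
      · obtain ⟨b, hb⟩ := hleft a
        have h0 : (1 - r * b * π) * π = 0 := by
          rw [sub_mul, one_mul, sub_eq_zero]
          nth_rewrite 1 [← ht]
          rw [ha, mul_assoc r, mul_assoc r, mul_assoc r, ← hb]
          simp only [mul_assoc]
        have hz := (hone (r * b * π) ((hmem _).mpr ⟨_, rfl⟩)).mul_right_eq_zero.mp h0
        exact ⟨0, by rw [hz]; simp⟩
      · obtain ⟨c, hc⟩ := hu.exists_right_inv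
        refine ⟨c, ?_⟩
        nth_rewrite 2 [← ht]
        rw [mul_assoc, hc, mul_one]
    · obtain ⟨t, ht⟩ := Submodule.mem_span_singleton.mp
        (hle (Submodule.mem_span_singleton_self (r * π)))
      rw [← MulOpposite.op_unop t, op_smul_eq_mul] at ht
      exact ⟨_, ht.symm⟩
  refine ⟨π, h.finite, hmax, hcases, hleft, fun r => ?_, hq, hs, hπ, fun t ht ht0 => ?_⟩
  -- A nonunit `r` reduces to the unit `1 - r`.
  · by_cases hr : r ∈ Ideal.span {π}
    · obtain ⟨a, ha⟩ := hrightunit _ (hone r hr)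
      refine ⟨1 - a, ?_⟩
      rw [mul_sub, ← ha]
      noncomm_ring
    · exact hrightunit r (hunit r hr)
  · rcases Nat.eq_zero_or_pos t with rfl | hpos
    · rw [pow_zero] at ht0
      exact hnot 1 (by rw [ht0]; exact zero_mem _) isUnit_one
    · exact absurd (hleast ⟨hpos, ht0⟩) (not_le.mpr ht)

namespace IsUniformizer

variable (h : IsUniformizer π q s)

include h

lemma not_isUnit_mul (a : R) : ¬ IsUnit (a * π) := fun hu =>
  h.isMaximal.ne_top (Ideal.eq_top_of_isUnit_mem _
    (Ideal.mem_span_singleton'.mpr ⟨a, rfl⟩) hu)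

lemma mem_span_iff (r : R) : r ∈ Ideal.span {π} ↔ ¬ IsUnit r := by
  refine ⟨fun hr => ?_, fun hr => ?_⟩
  · obtain ⟨a, rfl⟩ := Ideal.mem_span_singleton'.mp hr
    exact h.not_isUnit_mul a
  · obtain ⟨a, rfl⟩ := (h.mem_or_isUnit r).resolve_right hr
    exact Ideal.mem_span_singleton'.mpr ⟨a, rfl⟩

lemma exists_mul_pow_eq (j : ℕ) (r : R) : ∃ a, r * π ^ j = π ^ j * a := by
  induction j generalizing r with
  | zero => exact ⟨r, by simp⟩
  | succ j ih =>
    obtain ⟨a, ha⟩ := ih r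
    obtain ⟨b, hb⟩ := h.right_of_left a
    exact ⟨b, by rw [pow_succ, ← mul_assoc, ha, mul_assoc, hb, mul_assoc]⟩

lemma two_le : 2 ≤ q := by
  have := h.finite
  rw [← h.card_quotient]
  have : Finite (R ⧸ Ideal.span {π}) := Finite.of_surjective _ (Submodule.mkQ_surjective _)
  have : Nontrivial (R ⧸ Ideal.span {π}) :=
    Submodule.Quotient.nontrivial_iff.mpr h.isMaximal.ne_top
  exact Finite.one_lt_card

omit h in
/-- The submodule `π ^ j • X` of a module `X`. -/
def layer (h : IsUniformizer π q s) (X : Type*) [AddCommGroup X] [Module R X] (j : ℕ) :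
    Submodule R X where
  carrier := {x | ∃ y, x = π ^ j • y}
  add_mem' := by
    rintro _ _ ⟨y, rfl⟩ ⟨z, rfl⟩
    exact ⟨y + z, (smul_add _ _ _).symm⟩
  zero_mem' := ⟨0, (smul_zero _).symm⟩
  smul_mem' := by
    rintro r _ ⟨y, rfl⟩
    obtain ⟨a, ha⟩ := h.exists_mul_pow_eq j r
    exact ⟨a • y, by rw [← mul_smul, ha, mul_smul]⟩

end IsUniformizer

end Ring

/-! ### Cardinalities of layers and socles. -/

lemma AddSubgroup.card_eq_card_map_mul {X Z : Type*} [AddGroup X] [AddGroup Z] (f : X →+ Z)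
    (A : AddSubgroup X) :
    Nat.card A = Nat.card (A.map f) * Nat.card (f.ker ⊓ A : AddSubgroup X) := by
  rw [← AddSubgroup.relIndex_ker, ← (f.ker.addSubgroupOf A).card_mul_index, mul_comm]
  congr 1
  rw [← AddSubgroup.addSubgroupOf_map_subtype]
  exact Nat.card_congr
    ((f.ker.addSubgroupOf A).equivMapOfInjective A.subtype A.subtype_injective).toEquiv

section Modules

variable {R : Type u} [Ring R]

lemma Submodule.card_sup_mul_card_inf {X : Type*} [AddCommGroup X] [Module R X]
    (A B : Submodule R X) :
    Nat.card (A ⊔ B : Submodule R X) * Nat.card (A ⊓ B : Submodule R X) =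
      Nat.card A * Nat.card B := by
  have h1 := AddSubgroup.card_eq_card_map_mul B.mkQ.toAddMonoidHom (A ⊔ B).toAddSubgroup
  have h2 := AddSubgroup.card_eq_card_map_mul B.mkQ.toAddMonoidHom A.toAddSubgroup
  have hk : B.mkQ.toAddMonoidHom.ker = B.toAddSubgroup := by
    ext x; simp [AddMonoidHom.mem_ker]
  have h3 : (A ⊔ B).toAddSubgroup.map B.mkQ.toAddMonoidHom =
      A.toAddSubgroup.map B.mkQ.toAddMonoidHom := by
    have : (A ⊔ B).map B.mkQ = A.map B.mkQ := by rw [Submodule.map_sup, Submodule.mkQ_map_self]; simp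
    exact congrArg Submodule.toAddSubgroup this
  have h4 : B.toAddSubgroup ⊓ (A ⊔ B).toAddSubgroup = B.toAddSubgroup :=
    inf_eq_left.mpr fun x hx => (le_sup_right : B ≤ A ⊔ B) hx
  have h5 : B.toAddSubgroup ⊓ A.toAddSubgroup = (A ⊓ B).toAddSubgroup := by
    rw [inf_comm]; rfl
  rw [hk, h3, h4] at h1
  rw [hk, h5] at h2
  change Nat.card (A ⊔ B).toAddSubgroup * Nat.card (A ⊓ B).toAddSubgroup =
    Nat.card A.toAddSubgroup * Nat.card B.toAddSubgroup
  rw [h1, h2]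
  ring

namespace IsUniformizer

variable {π : R} {q s : ℕ} (h : IsUniformizer π q s)

lemma mem_layer {X : Type*} [AddCommGroup X] [Module R X] {j : ℕ} {x : X} :
    x ∈ h.layer X j ↔ ∃ y, x = π ^ j • y := Iff.rfl

include h

section Basic

variable {X : Type*} [AddCommGroup X] [Module R X]

lemma layer_zero : h.layer X 0 = ⊤ := by
  ext x; simp [mem_layer]

lemma layer_self : h.layer X s = ⊥ := by
  ext x; simp [mem_layer, h.pow_eq_zero]

lemma layer_succ_le (j : ℕ) : h.layer X (j + 1) ≤ h.layer X j := by
  rintro _ ⟨y, rfl⟩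
  exact ⟨π • y, by rw [pow_succ, mul_smul]⟩

lemma layer_antitone : Antitone (h.layer X) := antitone_nat_of_succ_le h.layer_succ_le

lemma smul_mem_layer {j : ℕ} {x : X} (hx : x ∈ h.layer X j) : π • x ∈ h.layer X (j + 1) := by
  obtain ⟨y, rfl⟩ := hx
  exact ⟨y, by rw [← mul_smul, pow_succ']⟩

lemma exists_smul_eq_of_mem_layer {j : ℕ} {x : X} (hx : x ∈ h.layer X (j + 1)) :
    ∃ y ∈ h.layer X j, π • y = x := by
  obtain ⟨y, rfl⟩ := hx
  exact ⟨π ^ j • y, ⟨y, rfl⟩, by rw [← mul_smul, pow_succ']⟩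

/-- `{x ∈ A | π • x ∈ N}`, the submodule of `A` whose image modulo `N` is the socle, if
`N ≤ A`. -/
def socle (h : IsUniformizer π q s) (A N : Submodule R X) : Submodule R X where
  carrier := {x | x ∈ A ∧ π • x ∈ N}
  add_mem' := fun hx hy => ⟨add_mem hx.1 hy.1, by rw [smul_add]; exact add_mem hx.2 hy.2⟩
  zero_mem' := ⟨zero_mem _, by rw [smul_zero]; exact zero_mem _⟩
  smul_mem' := by
    rintro r x ⟨h1, h2⟩
    obtain ⟨a, ha⟩ := h.left_of_right r
    exact ⟨A.smul_mem r h1, by rw [← mul_smul, ha, mul_smul]; exact N.smul_mem a h2⟩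

omit h in
lemma mem_socle (h : IsUniformizer π q s) {A N : Submodule R X} {x : X} :
    x ∈ h.socle A N ↔ x ∈ A ∧ π • x ∈ N := Iff.rfl

/-- Count kernel and image of `x ↦ π • x` from `A` to `X ⧸ N`. The map is only additive, since `π`
need not be central. -/
lemma card_socle_mul {A B N : Submodule R X} [Finite X] (hAB : ∀ x ∈ A, π • x ∈ B)
    (hBA : ∀ y ∈ B, ∃ x ∈ A, π • x = y) :
    Nat.card (h.socle A N) * Nat.card (N ⊔ B : Submodule R X) = Nat.card A * Nat.card N := by
  set f : X →+ X ⧸ N := N.mkQ.toAddMonoidHom.comp (DistribSMul.toAddMonoidHom X π) with hf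
  have h1 := AddSubgroup.card_eq_card_map_mul f A.toAddSubgroup
  have h2 := AddSubgroup.card_eq_card_map_mul N.mkQ.toAddMonoidHom B.toAddSubgroup
  have hk : f.ker ⊓ A.toAddSubgroup = (h.socle A N).toAddSubgroup := by
    ext x
    rw [AddSubgroup.mem_inf, AddMonoidHom.mem_ker]
    change Submodule.Quotient.mk (π • x) = 0 ∧ x ∈ A ↔ x ∈ A ∧ π • x ∈ N
    rw [Submodule.Quotient.mk_eq_zero, and_comm]
  have hm : A.toAddSubgroup.map f = B.toAddSubgroup.map N.mkQ.toAddMonoidHom := by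
    ext z
    constructor
    · rintro ⟨x, hx, rfl⟩
      exact ⟨π • x, hAB x hx, rfl⟩
    · rintro ⟨y, hy, rfl⟩
      obtain ⟨x, hx, rfl⟩ := hBA y hy
      exact ⟨x, hx, rfl⟩
  have hk2 : N.mkQ.toAddMonoidHom.ker ⊓ B.toAddSubgroup = (N ⊓ B).toAddSubgroup := by
    ext x; simp [AddMonoidHom.mem_ker]
  have h3 := Submodule.card_sup_mul_card_inf N B
  rw [hk, hm] at h1
  rw [hk2] at h2
  have hpos : 0 < Nat.card (N ⊓ B).toAddSubgroup := Nat.card_pos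
  change Nat.card A = _ * Nat.card (h.socle A N) at h1
  change Nat.card B = _ at h2
  change _ * Nat.card (N ⊓ B).toAddSubgroup = _ at h3
  refine Nat.eq_of_mul_eq_mul_right hpos ?_
  rw [mul_assoc, h3, h2, h1]
  ring

/-- The quotient by `U` is cyclic and nonzero and is killed by the maximal left ideal, so it is `R ⧸
Ideal.span {π}`. -/
lemma card_sup_span {U : Submodule R X} [Finite X] {v : X} (hv : v ∉ U) (hπ : π • v ∈ U) :
    Nat.card (U ⊔ Submodule.span R {v} : Submodule R X) = q * Nat.card U := by
  have hfin := h.finite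
  have h1 := Submodule.card_sup_mul_card_inf U (Submodule.span R {v})
  set g : R →ₗ[R] X ⧸ U := U.mkQ.comp (LinearMap.toSpanSingleton R X v) with hg
  have hker : LinearMap.ker g = Ideal.span {π} := by
    symm
    refine h.isMaximal.eq_of_le ?_ ?_
    · intro htop
      have : (1 : R) ∈ LinearMap.ker g := by rw [htop]; trivial
      rw [LinearMap.mem_ker] at this
      simp [hg] at this
      exact hv this
    · rw [Ideal.span_singleton_le_iff_mem, LinearMap.mem_ker]
      exact (Submodule.Quotient.mk_eq_zero U).mpr hπ
  have h2 : Nat.card (LinearMap.range g) = q := by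
    rw [← Nat.card_congr g.quotKerEquivRange.toEquiv, hker, h.card_quotient]
  have h3 : LinearMap.range g = (Submodule.span R {v}).map U.mkQ := by
    rw [hg, LinearMap.range_comp, LinearMap.range_toSpanSingleton]
  have h4 := AddSubgroup.card_eq_card_map_mul U.mkQ.toAddMonoidHom
    (Submodule.span R {v}).toAddSubgroup
  have h5 : (Submodule.span R {v}).toAddSubgroup.map U.mkQ.toAddMonoidHom =
    (LinearMap.range g).toAddSubgroup := by rw [h3]; rfl
  have h6 : U.mkQ.toAddMonoidHom.ker ⊓ (Submodule.span R {v}).toAddSubgroup =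
      (U ⊓ Submodule.span R {v}).toAddSubgroup := by
    ext x; simp [AddMonoidHom.mem_ker]
  rw [h5, h6] at h4
  change Nat.card (Submodule.span R {v}) = Nat.card (LinearMap.range g) *
    Nat.card (U ⊓ Submodule.span R {v} : Submodule R X) at h4
  have hpos : 0 < Nat.card (U ⊓ Submodule.span R {v} : Submodule R X) := Nat.card_pos
  refine Nat.eq_of_mul_eq_mul_right hpos ?_
  rw [h1, h4, h2]
  ring

end Basic

section Pi

variable {n : ℕ}

lemma mem_layer_one_of_pow_smul_eq_zero {a : ℕ} (ha : a < s) {x : Fin n → R}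
    (hx : π ^ a • x = 0) : x ∈ h.layer (Fin n → R) 1 := by
  have : ∀ i, ∃ b, x i = π * b := by
    intro i
    rcases h.mem_or_isUnit (x i) with ⟨b, hb⟩ | hu
    · obtain ⟨c, hc⟩ := h.right_of_left b
      exact ⟨c, by rw [hb, hc]⟩
    · have h0 : π ^ a * x i = 0 := congrFun hx i
      exact absurd (hu.mul_left_eq_zero.mp h0) (h.pow_ne_zero a ha)
  choose b hb using this
  exact ⟨b, by ext i; simp [hb i]⟩

lemma mem_layer_of_pow_smul_eq_zero {a i : ℕ} (ha : a + i ≤ s) {x : Fin n → R}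
    (hx : π ^ a • x = 0) : x ∈ h.layer (Fin n → R) i := by
  induction i with
  | zero => rw [h.layer_zero]; trivial
  | succ i ih =>
    obtain ⟨y, rfl⟩ := ih (by omega)
    rw [← mul_smul, ← pow_add] at hx
    obtain ⟨z, rfl⟩ := h.mem_layer_one_of_pow_smul_eq_zero (by omega) hx
    exact ⟨z, by rw [pow_one, ← mul_smul, pow_succ]⟩

/-- Multiplication by `π` maps layer `j` onto layer `j + 1` with kernel layer `s - 1`, so all
successive quotients have equal size. -/
lemma card_layer_mul_layer_sub_one {j : ℕ} (hj : j < s) :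
    Nat.card (h.layer (Fin n → R) j) =
      Nat.card (h.layer (Fin n → R) (s - 1)) * Nat.card (h.layer (Fin n → R) (j + 1)) := by
  have hfin := h.finite
  have h1 := h.card_socle_mul (A := h.layer (Fin n → R) j) (B := h.layer (Fin n → R) (j + 1))
    (N := ⊥) (fun x hx => h.smul_mem_layer hx) (fun y hy => h.exists_smul_eq_of_mem_layer hy)
  have h2 : h.socle (h.layer (Fin n → R) j) ⊥ = h.layer (Fin n → R) (s - 1) := by
    ext x
    rw [mem_socle, Submodule.mem_bot]
    have hs := h.pos
    constructor
    · rintro ⟨-, hx⟩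
      exact h.mem_layer_of_pow_smul_eq_zero (a := 1) (by omega) (by rwa [pow_one])
    · intro hx
      refine ⟨h.layer_antitone (by omega) hx, ?_⟩
      have := h.smul_mem_layer hx
      rwa [Nat.sub_add_cancel hs, h.layer_self, Submodule.mem_bot] at this
  rw [h2, bot_sup_eq] at h1
  simpa using h1.symm

lemma card_eq_pow_mul_card_layer_one :
    Nat.card (Fin n → R) = q ^ n * Nat.card (h.layer (Fin n → R) 1) := by
  have hfin := h.finite
  set g : (Fin n → R) →+ (Fin n → R ⧸ Ideal.span {π}) :=
    (Submodule.mkQ (Ideal.span {π})).toAddMonoidHom.compLeft (Fin n) with hg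
  have h1 := AddSubgroup.card_eq_card_map_mul g ⊤
  have hsurj : Function.Surjective g := fun y => by
    choose x hx using fun i => Submodule.mkQ_surjective (Ideal.span {π}) (y i)
    exact ⟨x, funext hx⟩
  rw [← AddMonoidHom.range_eq_map, AddMonoidHom.range_eq_top.mpr hsurj, AddSubgroup.card_top,
    AddSubgroup.card_top, inf_top_eq, Nat.card_fun (β := R ⧸ Ideal.span {π}), h.card_quotient, Nat.card_fin] at h1
  have hk : g.ker = (h.layer (Fin n → R) 1).toAddSubgroup := by
    ext x
    rw [AddMonoidHom.mem_ker]
    constructor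
    · intro hx
      have : ∀ i, ∃ b, x i = π * b := by
        intro i
        have h0 : x i ∈ Ideal.span {π} := (Submodule.Quotient.mk_eq_zero _).mp (congrFun hx i)
        obtain ⟨b, hb⟩ := Ideal.mem_span_singleton'.mp h0
        obtain ⟨c, hc⟩ := h.right_of_left b
        exact ⟨c, by rw [← hb, hc]⟩
      choose b hb using this
      exact ⟨b, by ext i; simp [hb i]⟩
    · rintro ⟨y, rfl⟩
      ext i
      refine (Submodule.Quotient.mk_eq_zero _).mpr ?_
      obtain ⟨a, ha⟩ := h.left_of_right (y i)
      exact Ideal.mem_span_singleton'.mpr ⟨a, by simp [ha]⟩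
  rw [hk] at h1
  exact h1

lemma card_layer {j : ℕ} (hj : j < s) :
    Nat.card (h.layer (Fin n → R) j) = q ^ n * Nat.card (h.layer (Fin n → R) (j + 1)) := by
  have hfin := h.finite
  have h0 := h.card_layer_mul_layer_sub_one (n := n) h.pos
  have h1 := h.card_eq_pow_mul_card_layer_one (n := n)
  rw [h.layer_zero, Nat.card_congr Submodule.topEquiv.toEquiv, zero_add, h1] at h0
  have := Nat.eq_of_mul_eq_mul_right Nat.card_pos h0
  rw [h.card_layer_mul_layer_sub_one hj, this]

end Pi

end IsUniformizer

end Modules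

/-! ### Counting by fibres and by independent lists. -/

lemma Set.ncard_eq_sum_ncard_fiber {α β : Type*} {s : Set α} {t : Set β} (hs : s.Finite)
    (ht : t.Finite) {f : α → β} (hf : Set.MapsTo f s t) :
    s.ncard = ∑ b ∈ ht.toFinset, {a ∈ s | f a = b}.ncard := by
  classical
  rw [Set.ncard_eq_toFinset_card s hs,
    Finset.card_eq_sum_card_fiberwise (f := f) (t := ht.toFinset) (by simpa using hf)]
  refine Finset.sum_congr rfl fun b _ => ?_
  rw [← Set.ncard_coe_finset]
  congr 1
  ext a
  simp

lemma Set.ncard_eq_mul_of_ncard_fiber {α β : Type*} {s : Set α} {t : Set β} (hs : s.Finite)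
    (ht : t.Finite) {f : α → β} (hf : Set.MapsTo f s t) {c : ℕ}
    (hc : ∀ b ∈ t, {a ∈ s | f a = b}.ncard = c) : s.ncard = t.ncard * c := by
  rw [Set.ncard_eq_sum_ncard_fiber hs ht hf, Finset.sum_congr rfl
    (fun b hb => hc b (ht.mem_toFinset.mp hb)), Finset.sum_const, smul_eq_mul,
    Set.ncard_eq_toFinset_card t ht]

section Lists

variable {R : Type u} [Ring R] {X : Type*} [AddCommGroup X] [Module R X]

lemma Submodule.eq_of_le_of_card_le [Finite X] {A B : Submodule R X} (hle : A ≤ B)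
    (hc : Nat.card B ≤ Nat.card A) : A = B :=
  SetLike.coe_injective (Set.eq_of_subset_of_ncard_le hle hc)

lemma Submodule.card_mono' [Finite X] {A B : Submodule R X} (hle : A ≤ B) :
    Nat.card A ≤ Nat.card B :=
  Set.ncard_le_ncard (s := (A : Set X)) (t := B) hle

variable (R) in
/-- The submodule generated by `B` and the members of a list. -/
def Submodule.adjoinList (B : Submodule R X) : List X → Submodule R X
  | [] => B
  | v :: l => B.adjoinList l ⊔ Submodule.span R {v}

/-- Every member of the list lies outside of the submodule generated by `B` and the members that
follow it. -/
def Submodule.IsIndepList (B : Submodule R X) : List X → Prop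
  | [] => True
  | v :: l => v ∉ B.adjoinList R l ∧ B.IsIndepList l

/-- The independent lists of length `m` over `B` with members in `S`. -/
def Submodule.indepLists (B S : Submodule R X) (m : ℕ) : Set (List X) :=
  {l | l.length = m ∧ B.IsIndepList l ∧ ∀ v ∈ l, v ∈ S}

namespace Submodule

lemma le_adjoinList (B : Submodule R X) (l : List X) : B ≤ B.adjoinList R l := by
  induction l with
  | nil => exact le_rfl
  | cons v l ih => exact ih.trans le_sup_left

lemma mem_adjoinList (B : Submodule R X) {l : List X} {v : X} (hv : v ∈ l) :
    v ∈ B.adjoinList R l := by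
  induction l with
  | nil => simp at hv
  | cons w l ih =>
    rcases List.mem_cons.mp hv with rfl | hv
    · exact (le_sup_right : _ ≤ B.adjoinList R l ⊔ span R {v}) (mem_span_singleton_self v)
    · exact (le_sup_left : _ ≤ B.adjoinList R l ⊔ span R {w}) (ih hv)

lemma adjoinList_le {B S : Submodule R X} (hB : B ≤ S) {l : List X} (hl : ∀ v ∈ l, v ∈ S) :
    B.adjoinList R l ≤ S := by
  induction l with
  | nil => exact hB
  | cons w l ih =>
    exact sup_le (ih fun v hv => hl v (List.mem_cons_of_mem w hv))
      ((span_singleton_le_iff_mem _ _).mpr (hl w List.mem_cons_self))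

lemma adjoinList_sup (B C : Submodule R X) (l : List X) :
    (B ⊔ C).adjoinList R l = B ⊔ C.adjoinList R l := by
  induction l with
  | nil => rfl
  | cons v l ih => rw [adjoinList, ih, adjoinList, sup_assoc]

lemma IsIndepList.mono {B C : Submodule R X} (h : B ≤ C) {l : List X} (hl : C.IsIndepList l) :
    B.IsIndepList l := by
  induction l with
  | nil => trivial
  | cons v l ih =>
    refine ⟨fun hv => hl.1 ?_, ih hl.2⟩
    rw [← sup_eq_left.mpr h, adjoinList_sup]
    exact (le_sup_right : _ ≤ C ⊔ B.adjoinList R l) hv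

/-- By the modular law, a dependence over `C` among members of `N` is already one over `N ⊓ C`. -/
lemma IsIndepList.of_inf_eq {B C N : Submodule R X} (h : N ⊓ C = B) {l : List X}
    (hl : B.IsIndepList l) (hN : ∀ v ∈ l, v ∈ N) : C.IsIndepList l := by
  induction l with
  | nil => trivial
  | cons v l ih =>
    have hN' : ∀ v ∈ l, v ∈ N := fun w hw => hN w (List.mem_cons_of_mem v hw)
    refine ⟨fun hv => hl.1 ?_, ih hl.2 hN'⟩
    have hB : B ≤ C := h ▸ inf_le_right
    have hle : B.adjoinList R l ≤ N := adjoinList_le (h ▸ inf_le_left) hN'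
    rw [← sup_eq_left.mpr hB, adjoinList_sup, sup_comm] at hv
    have hmem : v ∈ (B.adjoinList R l ⊔ C) ⊓ N := ⟨hv, hN v List.mem_cons_self⟩
    rw [sup_inf_assoc_of_le _ hle, inf_comm, h, sup_eq_left.mpr (le_adjoinList B l)] at hmem
    exact hmem

end Submodule

end Lists

namespace IsUniformizer

open Submodule

variable {R : Type u} [Ring R] {X : Type*} [AddCommGroup X] [Module R X] [Finite X]
  {π : R} {q s : ℕ} (h : IsUniformizer π q s)

include h

lemma card_adjoinList_of_isIndepList {B S : Submodule R X} (hS : ∀ v ∈ S, π • v ∈ B)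
    {l : List X} (hl : B.IsIndepList l) (hlS : ∀ v ∈ l, v ∈ S) :
    Nat.card (B.adjoinList R l) = q ^ l.length * Nat.card B := by
  induction l with
  | nil => simp [adjoinList]
  | cons v l ih =>
    rw [adjoinList, h.card_sup_span hl.1 (le_adjoinList B l (hS v (hlS v List.mem_cons_self))),
      ih hl.2 fun w hw => hlS w (List.mem_cons_of_mem v hw), List.length_cons, pow_succ]
    ring

lemma card_adjoinList_le {B S : Submodule R X} (hS : ∀ v ∈ S, π • v ∈ B)
    {l : List X} (hlS : ∀ v ∈ l, v ∈ S) :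
    Nat.card (B.adjoinList R l) ≤ q ^ l.length * Nat.card B := by
  induction l with
  | nil => simp [adjoinList]
  | cons v l ih =>
    have ih := ih fun w hw => hlS w (List.mem_cons_of_mem v hw)
    have hq := h.two_le
    rw [adjoinList, List.length_cons, pow_succ']
    by_cases hv : v ∈ B.adjoinList R l
    · rw [sup_eq_left.mpr ((span_singleton_le_iff_mem _ _).mpr hv)]
      nlinarith
    · rw [h.card_sup_span hv (le_adjoinList B l (hS v (hlS v List.mem_cons_self))), mul_assoc]
      exact Nat.mul_le_mul_left q ih

lemma ncard_indepLists {B S : Submodule R X} (hBS : B ≤ S) (hS : ∀ v ∈ S, π • v ∈ B) (m : ℕ) :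
    (B.indepLists S m).ncard = ∏ i ∈ Finset.range m, (Nat.card S - q ^ i * Nat.card B) := by
  have hfin : ∀ m, (B.indepLists S m).Finite := fun m =>
    (List.finite_length_eq X m).subset fun l hl => hl.1
  induction m with
  | zero =>
    have : B.indepLists S 0 = {[]} := by
      ext l
      simp only [indepLists, List.length_eq_zero_iff, Set.mem_ofPred_eq, Set.mem_singleton_iff]
      refine ⟨fun h => h.1, fun h => ?_⟩
      subst h
      exact ⟨rfl, trivial, by simp⟩
    simp [this]
  | succ m ih =>
    rw [Finset.prod_range_succ, ← ih]
    refine Set.ncard_eq_mul_of_ncard_fiber (hfin _) (hfin _) (f := List.tail) ?_ ?_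
    · rintro (_ | ⟨v, l⟩) ⟨hl1, hl2, hl3⟩
      · simp at hl1
      · exact ⟨by simpa using hl1, hl2.2, fun w hw => hl3 w (List.mem_cons_of_mem v hw)⟩
    · intro l hl
      have h1 : {a ∈ B.indepLists S (m + 1) | a.tail = l} =
          (fun v => v :: l) '' ((S : Set X) \ (B.adjoinList R l : Set X)) := by
        ext a
        constructor
        · rintro ⟨⟨ha1, ha2, ha3⟩, rfl⟩
          rcases a with _ | ⟨v, a⟩
          · simp at ha1
          · exact ⟨v, ⟨ha3 v List.mem_cons_self, ha2.1⟩, rfl⟩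
        · rintro ⟨v, ⟨hv1, hv2⟩, rfl⟩
          refine ⟨⟨by simp [hl.1], ⟨hv2, hl.2.1⟩, fun w hw => ?_⟩, rfl⟩
          rcases List.mem_cons.mp hw with rfl | hw
          · exact hv1
          · exact hl.2.2 w hw
      rw [h1, Set.ncard_image_of_injective _ (fun a b hab => (List.cons.inj hab).1),
        Set.ncard_sdiff (adjoinList_le hBS hl.2.2)]
      have h2 := h.card_adjoinList_of_isIndepList hS hl.2.1 hl.2.2
      rw [hl.1] at h2
      rw [← h2]
      rfl

/-- Double count of the lists in `S` independent over `B`: each generates over `N` one such `A`, and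
each `A` arises from all its lists independent over `N`. -/
lemma ncard_relComplement {N B S : Submodule R X} (hNB : N ≤ B) (hBS : B ≤ S)
    (hS : ∀ v ∈ S, π • v ∈ N) (m : ℕ) :
    {A : Submodule R X | A ≤ S ∧ A ⊓ B = N ∧ Nat.card A = q ^ m * Nat.card N}.ncard *
        ∏ i ∈ Finset.range m, (q ^ m * Nat.card N - q ^ i * Nat.card N) =
      ∏ i ∈ Finset.range m, (Nat.card S - q ^ i * Nat.card B) := by
  have hq : 0 < q ^ m := pow_pos (by have := h.two_le; omega) m
  rw [← h.ncard_indepLists hBS (fun v hv => hNB (hS v hv))]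
  symm
  refine Set.ncard_eq_mul_of_ncard_fiber ((List.finite_length_eq X m).subset fun l hl => hl.1)
    (Set.toFinite _) (f := N.adjoinList R) ?_ ?_
  · rintro l ⟨hl1, hl2, hl3⟩
    have hle := adjoinList_le (hNB.trans hBS) hl3
    have c1 := h.card_adjoinList_of_isIndepList (fun v hv => hNB (hS v hv)) hl2 hl3
    have c2 := h.card_adjoinList_le hS hl3
    have c3 := Submodule.card_sup_mul_card_inf (N.adjoinList R l) B
    rw [sup_comm, ← adjoinList_sup, sup_eq_left.mpr hNB, c1, hl1] at c3
    rw [hl1] at c2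
    have hBpos : 0 < Nat.card B := Nat.card_pos
    -- Independence over `B` fixes the size of the sum with `B`, while the generated module has at
    -- most `q ^ m * Nat.card N` elements; so its intersection with `B` is no larger than `N`.
    have c4 : q ^ m * Nat.card (N.adjoinList R l ⊓ B : Submodule R X) =
        Nat.card (N.adjoinList R l) := by
      refine Nat.eq_of_mul_eq_mul_right hBpos ?_
      rw [← c3]; ring
    have hNle : N ≤ N.adjoinList R l ⊓ B := le_inf (le_adjoinList N l) hNB
    have c5 := Submodule.card_mono' hNle
    have c6 : Nat.card (N.adjoinList R l ⊓ B : Submodule R X) ≤ Nat.card N :=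
      Nat.le_of_mul_le_mul_left (c4.trans_le c2) hq
    have e := Submodule.eq_of_le_of_card_le hNle c6
    refine ⟨hle, e.symm, ?_⟩
    rw [← c4, ← e]
  · rintro A ⟨hA1, hA2, hA3⟩
    have hNA : N ≤ A := hA2 ▸ inf_le_left
    have hAS : ∀ v ∈ A, π • v ∈ N := fun v hv => hS v (hA1 hv)
    rw [← hA3, ← h.ncard_indepLists hNA hAS]
    congr 1
    ext l
    constructor
    · rintro ⟨⟨hl1, hl2, hl3⟩, rfl⟩
      exact ⟨hl1, hl2.mono hNB, fun v hv => mem_adjoinList N hv⟩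
    · rintro ⟨hl1, hl2, hl3⟩
      refine ⟨⟨hl1, hl2.of_inf_eq hA2 hl3, fun v hv => hA1 (hl3 v hv)⟩, ?_⟩
      refine Submodule.eq_of_le_of_card_le (adjoinList_le hNA hl3) ?_
      rw [h.card_adjoinList_of_isIndepList hAS hl2 hl3, hl1, hA3]

end IsUniformizer

/-! ### Counting submodules by profile. -/

lemma qPoch_eq_prod_range_sub (x : ℝ) (m : ℕ) :
    qPoch x m = ∏ i ∈ Finset.range m, (1 - x ^ (m - i)) := by
  rw [qPoch, ← Finset.prod_range_reflect]
  refine Finset.prod_congr rfl fun i hi => ?_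
  rw [show m - 1 - i + 1 = m - i by have := Finset.mem_range.mp hi; omega]

lemma qPoch_eq_mul_prod_range_sub (x : ℝ) {m n : ℕ} (h : m ≤ n) :
    qPoch x n = qPoch x (n - m) * ∏ i ∈ Finset.range m, (1 - x ^ (n - i)) := by
  obtain ⟨c, rfl⟩ := Nat.exists_eq_add_of_le' h
  rw [Nat.add_sub_cancel, qPoch_add, ← Finset.prod_range_reflect]
  congr 1
  refine Finset.prod_congr rfl fun i hi => ?_
  rw [show c + (m - 1 - i) + 1 = c + m - i by have := Finset.mem_range.mp hi; omega]

/-- Extracting powers of `q` from the factors turns the quotient of products into `q^(m(n-m))` times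
the Gaussian binomial of `k` over `m` in `1/q`. -/
lemma eq_of_mul_prod_eq_prod {a q n m k c cS cB : ℕ} (hq : 2 ≤ q) (hc : 0 < c) (hk : k ≤ n)
    (hS : cS = q ^ n * c) (hB : q ^ k * cB = q ^ n * c)
    (h : a * ∏ i ∈ Finset.range m, (q ^ m * c - q ^ i * c) =
      ∏ i ∈ Finset.range m, (cS - q ^ i * cB)) :
    (a : ℝ) = (q : ℝ) ^ ((m : ℤ) * (n - m)) * qPoch (1 / q) k * stepWeight (1 / q) m k /
      qPoch (1 / q) m := by
  have hq0 : (q : ℝ) ≠ 0 := by positivity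
  have hq1 : (1 / q : ℝ) < 1 := by
    rw [div_lt_one (by positivity)]; exact_mod_cast hq
  have hx0 : (0 : ℝ) ≤ 1 / q := by positivity
  have hqm : 0 < q := by omega
  have hB' : cB = q ^ (n - k) * c := by
    refine Nat.eq_of_mul_eq_mul_left (pow_pos hqm k) ?_
    rw [hB, ← mul_assoc, ← pow_add, Nat.add_sub_cancel' hk]
  rcases lt_or_ge k m with hkm | hkm
  · rw [stepWeight_of_lt hkm, mul_zero, zero_div]
    -- For `k < m` the factor at `i = k` is zero.
    rw [Finset.prod_eq_zero (s := Finset.range m) (f := fun i => cS - q ^ i * cB)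
      (Finset.mem_range.mpr hkm) (by rw [hB, hS, Nat.sub_self])] at h
    have hpos : 0 < ∏ i ∈ Finset.range m, (q ^ m * c - q ^ i * c) := by
      refine Finset.prod_pos fun i hi => Nat.sub_pos_of_lt ?_
      exact Nat.mul_lt_mul_of_pos_right (Nat.pow_lt_pow_right (by omega)
        (Finset.mem_range.mp hi)) hc
    rw [(Nat.mul_eq_zero.mp h).resolve_right hpos.ne']
    simp
  · have e1 : ((∏ i ∈ Finset.range m, (q ^ m * c - q ^ i * c) : ℕ) : ℝ) =
        ((q : ℝ) ^ m * c) ^ m * qPoch (1 / q) m := by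
      rw [Nat.cast_prod, qPoch_eq_prod_range_sub, Finset.pow_eq_prod_const ((q : ℝ) ^ m * c) m,
        ← Finset.prod_mul_distrib]
      refine Finset.prod_congr rfl fun i hi => ?_
      have hi := Finset.mem_range.mp hi
      rw [Nat.cast_sub (Nat.mul_le_mul_right c (Nat.pow_le_pow_right hqm hi.le))]
      push_cast
      obtain ⟨d, rfl⟩ := Nat.exists_eq_add_of_le hi.le
      rw [Nat.add_sub_cancel_left, one_div, inv_pow, pow_add]
      field_simp
    have e2 : ((∏ i ∈ Finset.range m, (cS - q ^ i * cB) : ℕ) : ℝ) =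
        ((q : ℝ) ^ n * c) ^ m * ∏ i ∈ Finset.range m, (1 - (1 / q : ℝ) ^ (k - i)) := by
      rw [Nat.cast_prod, Finset.pow_eq_prod_const ((q : ℝ) ^ n * c) m, ← Finset.prod_mul_distrib]
      refine Finset.prod_congr rfl fun i hi => ?_
      have hi := Finset.mem_range.mp hi
      obtain ⟨d, rfl⟩ := Nat.exists_eq_add_of_le (hi.le.trans hkm)
      obtain ⟨e, rfl⟩ := Nat.exists_eq_add_of_le hk
      rw [Nat.add_sub_cancel_left] at hB'
      rw [hS, hB', Nat.cast_sub]
      · push_cast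
        rw [Nat.add_sub_cancel_left, one_div, inv_pow, pow_add, pow_add]
        field_simp
      · rw [← mul_assoc, ← pow_add]
        exact Nat.mul_le_mul_right c (Nat.pow_le_pow_right hqm (by omega))
    have h' := congrArg (Nat.cast : ℕ → ℝ) h
    rw [Nat.cast_mul, e1, e2] at h'
    have p1 := (qPoch_pos hx0 hq1 m).ne'
    have p2 := (qPoch_pos hx0 hq1 (k - m)).ne'
    have hc0 : (c : ℝ) ≠ 0 := by positivity
    rw [stepWeight, if_pos hkm, qPoch_eq_mul_prod_range_sub _ hkm, mul_sub, zpow_sub₀ hq0,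
      ← Nat.cast_mul, ← Nat.cast_mul, zpow_natCast, zpow_natCast, mul_comm m n, pow_mul, pow_mul]
    rw [mul_pow, mul_pow] at h'
    set P := ∏ i ∈ Finset.range m, (1 - (1 / q : ℝ) ^ (k - i))
    field_simp
    refine mul_left_cancel₀ (pow_ne_zero m hc0) ?_
    linear_combination h'

lemma Set.cast_ncard_eq_mul_of_ncard_fiber {α β : Type*} {s : Set α} {t : Set β} (hs : s.Finite)
    (ht : t.Finite) {f : α → β} (hf : Set.MapsTo f s t) {c : ℝ}
    (hc : ∀ b ∈ t, ({a ∈ s | f a = b}.ncard : ℝ) = c) : (s.ncard : ℝ) = t.ncard * c := by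
  rw [Set.ncard_eq_sum_ncard_fiber hs ht hf, Nat.cast_sum, Finset.sum_congr rfl
    (fun b hb => hc b (ht.mem_toFinset.mp hb)), Finset.sum_const, nsmul_eq_mul,
    Set.ncard_eq_toFinset_card t ht]

lemma chainSum_succ_eq_sum_range (x : ℝ) (v : ℕ → ℝ) (t a n ℓ : ℕ) :
    chainSum x v (t + 1) a n ℓ = ∑ m ∈ Finset.range (n + 1),
      if m ≤ ℓ then stepWeight x a m * v m * chainSum x v t m n (ℓ - m) else 0 := by
  rw [chainSum_succ, sum_antidiagonal_eq_sum_range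
    (fun m l => stepWeight x a m * v m * chainSum x v t m n l), ← Finset.sum_filter]
  symm
  refine Finset.sum_subset (fun m hm => ?_) fun m hm hm' => ?_
  · rw [Finset.mem_filter] at hm
    exact Finset.mem_range.mpr (Nat.lt_succ_of_le hm.2)
  · rw [chainSum_eq_zero_of_right_lt, mul_zero]
    rw [Finset.mem_range] at hm
    rw [Finset.mem_filter, Finset.mem_range] at hm'
    omega

/-- The weight `q ^ (m (n - m))`. -/
noncomputable def grassWeight (q n m : ℕ) : ℝ := (q : ℝ) ^ ((m : ℤ) * (n - m))

lemma grassWeight_eq {q : ℕ} (hq : q ≠ 0) (n k m : ℕ) : grassWeight q n m =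
    (q : ℝ) ^ k ^ 2 * ((q : ℝ) ^ ((n : ℤ) - 2 * k)) ^ m * centeredWeight (1 / q) k m := by
  have hq0 : (q : ℝ) ≠ 0 := Nat.cast_ne_zero.mpr hq
  rw [grassWeight, centeredWeight, one_div, inv_pow, ← zpow_natCast, ← zpow_natCast,
    ← zpow_natCast, ← zpow_mul, ← zpow_neg, ← zpow_add₀ hq0, ← zpow_add₀ hq0]
  congr 1
  push_cast
  rw [sq_abs]
  ring

namespace IsUniformizer

open Submodule

variable {R : Type u} [Ring R] {π : R} {q s : ℕ} (h : IsUniformizer π q s)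

include h

lemma card_eq_of_isSimpleModule {V : Type*} [AddCommGroup V] [Module R V] [IsSimpleModule R V] :
    Nat.card V = q := by
  obtain ⟨I, hI, ⟨e⟩⟩ := isSimpleModule_iff_quot_maximal.mp ‹IsSimpleModule R V›
  have : I = Ideal.span {π} := by
    refine hI.eq_of_le h.isMaximal.ne_top fun r hr => ?_
    rw [h.mem_span_iff]
    exact fun hu => hI.ne_top (Ideal.eq_top_of_isUnit_mem _ hr hu)
  rw [Nat.card_congr e.toEquiv, this, h.card_quotient]

lemma exists_length_eq_and_card_eq {V : Type*} [AddCommGroup V] [Module R V]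
    (hV : IsFiniteLength R V) : ∃ ℓ : ℕ, Module.length R V = ℓ ∧ Nat.card V = q ^ ℓ := by
  induction hV with
  | of_subsingleton => exact ⟨0, by simp, by simp⟩
  | of_simple_quotient hN ih =>
    rename_i V _ _ N _
    obtain ⟨ℓ, h1, h2⟩ := ih
    refine ⟨ℓ + 1, ?_, ?_⟩
    · rw [Module.length_eq_add_of_exact N.subtype N.mkQ N.injective_subtype N.mkQ_surjective
        (LinearMap.exact_subtype_mkQ N), h1, Module.length_eq_one]
      rfl
    · rw [N.card_eq_card_quotient_mul_card, h2, h.card_eq_of_isSimpleModule, pow_succ]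

lemma length_eq_iff_card_eq {V : Type*} [AddCommGroup V] [Module R V] [Finite V] {ℓ : ℕ} :
    Module.length R V = ℓ ↔ Nat.card V = q ^ ℓ := by
  obtain ⟨ℓ', h1, h2⟩ := h.exists_length_eq_and_card_eq (V := V)
    (isFiniteLength_iff_isNoetherian_isArtinian.mpr ⟨inferInstance, inferInstance⟩)
  rw [h1, h2, Nat.cast_inj, Nat.pow_right_injective h.two_le |>.eq_iff]

lemma exists_card_eq_pow {V : Type*} [AddCommGroup V] [Module R V] [Finite V] :
    ∃ ℓ, Nat.card V = q ^ ℓ := by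
  obtain ⟨ℓ, -, h2⟩ := h.exists_length_eq_and_card_eq (V := V)
    (isFiniteLength_iff_isNoetherian_isArtinian.mpr ⟨inferInstance, inferInstance⟩)
  exact ⟨ℓ, h2⟩

/-- The submodules of `π ^ j • R ^ n` of length `ℓ` with image of length `m` in
`π ^ j • R ^ n ⧸ π ^ (j + 1) • R ^ n`. -/
def profileSet (h : IsUniformizer π q s) (n j m ℓ : ℕ) : Set (Submodule R (Fin n → R)) :=
  {N | N ≤ h.layer (Fin n → R) j ∧ Nat.card N = q ^ ℓ ∧
    Nat.card N = q ^ m * Nat.card (N ⊓ h.layer (Fin n → R) (j + 1) : Submodule R (Fin n → R))}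

variable {n : ℕ}

lemma exists_profile {j : ℕ} (hj : j < s) {N : Submodule R (Fin n → R)}
    (hN : N ≤ h.layer (Fin n → R) j) : ∃ m ≤ n, Nat.card N =
      q ^ m * Nat.card (N ⊓ h.layer (Fin n → R) (j + 1) : Submodule R (Fin n → R)) := by
  have hfin := h.finite
  have hq := h.two_le
  set L := h.layer (Fin n → R) (j + 1)
  obtain ⟨a, ha⟩ := h.exists_card_eq_pow (V := N)
  obtain ⟨b, hb⟩ := h.exists_card_eq_pow (V := (N ⊓ L : Submodule R (Fin n → R)))
  have hle := Submodule.card_mono' (inf_le_left : N ⊓ L ≤ N)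
  rw [ha, hb] at hle
  have hab : b ≤ a := (Nat.pow_le_pow_iff_right hq).mp hle
  have h1 := Submodule.card_sup_mul_card_inf N L
  have h2 := Submodule.card_mono' (sup_le hN (h.layer_succ_le j))
  rw [h.card_layer hj] at h2
  refine ⟨a - b, ?_, by rw [ha, hb, ← pow_add, Nat.sub_add_cancel hab]⟩
  refine (Nat.pow_le_pow_iff_right hq).mp ?_
  have hpos : 0 < Nat.card L * q ^ b := Nat.mul_pos Nat.card_pos (pow_pos (by omega) b)
  refine Nat.le_of_mul_le_mul_right ?_ hpos
  calc q ^ (a - b) * (Nat.card L * q ^ b) = q ^ a * Nat.card L := by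
        nth_rewrite 2 [← Nat.sub_add_cancel hab]; rw [pow_add]; ring
    _ = Nat.card (N ⊔ L : Submodule R (Fin n → R)) * q ^ b := by rw [← ha, ← h1, hb]
    _ ≤ q ^ n * Nat.card L * q ^ b := Nat.mul_le_mul_right _ h2
    _ = _ := by ring

/-- Any such `N` satisfies `π N ⊆ N'`, so it lies in the socle over `N'` in layer `j`. There it is a
relative complement to the socle in layer `j + 1`, and `ncard_relComplement` applies. -/
lemma cast_ncard_fiber {j m m' : ℕ} (hj : j < s) {N' : Submodule R (Fin n → R)}
    (hN' : N' ≤ h.layer (Fin n → R) (j + 1)) (hm' : m' ≤ n)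
    (hc : q ^ m' * Nat.card (h.socle (h.layer (Fin n → R) (j + 1)) N') = q ^ n * Nat.card N') :
    ({N : Submodule R (Fin n → R) | N ≤ h.layer (Fin n → R) j ∧
      N ⊓ h.layer (Fin n → R) (j + 1) = N' ∧ Nat.card N = q ^ m * Nat.card N'}.ncard : ℝ) =
      grassWeight q n m * qPoch (1 / q) m' * stepWeight (1 / q) m m' / qPoch (1 / q) m := by
  have hfin := h.finite
  set L := h.layer (Fin n → R) (j + 1)
  set S := h.socle (h.layer (Fin n → R) j) N'
  have hBS : h.socle L N' = S ⊓ L := by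
    ext x
    simp only [mem_socle, Submodule.mem_inf, S]
    exact ⟨fun hx => ⟨⟨h.layer_succ_le j hx.1, hx.2⟩, hx.1⟩, fun hx => ⟨hx.2, hx.1.2⟩⟩
  have hset : {N : Submodule R (Fin n → R) | N ≤ h.layer (Fin n → R) j ∧
      N ⊓ L = N' ∧ Nat.card N = q ^ m * Nat.card N'} =
      {A | A ≤ S ∧ A ⊓ h.socle L N' = N' ∧ Nat.card A = q ^ m * Nat.card N'} := by
    ext A
    rw [hBS]
    constructor
    · rintro ⟨h1, h2, h3⟩
      have hAS : A ≤ S := fun x hx => ⟨h1 hx, by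
        rw [← h2]; exact ⟨A.smul_mem _ hx, h.smul_mem_layer (h1 hx)⟩⟩
      exact ⟨hAS, by rw [← inf_assoc, inf_eq_left.mpr hAS, h2], h3⟩
    · rintro ⟨h1, h2, h3⟩
      rw [← inf_assoc, inf_eq_left.mpr h1] at h2
      exact ⟨fun x hx => (h1 hx).1, h2, h3⟩
  have hcS : Nat.card S = q ^ n * Nat.card N' := by
    have h1 := h.card_socle_mul (A := h.layer (Fin n → R) j) (B := L) (N := N')
      (fun x hx => h.smul_mem_layer hx) (fun y hy => h.exists_smul_eq_of_mem_layer hy)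
    rw [sup_eq_right.mpr hN', h.card_layer hj] at h1
    refine Nat.eq_of_mul_eq_mul_right (Nat.card_pos (α := L)) ?_
    rw [h1]; ring
  rw [hset]
  refine eq_of_mul_prod_eq_prod h.two_le (Nat.card_pos (α := N')) hm' hcS hc
    (h.ncard_relComplement ?_ ?_ (fun v (hv : v ∈ S) => hv.2) m)
  · exact fun x hx => ⟨hN' hx, N'.smul_mem _ hx⟩
  · exact hBS ▸ inf_le_left

/-- Induction on the number of deeper layers, fibring over `N ⊓ L`. The fibre size brings the factor
`qPoch (1 / q) m'`, which cancels the denominator of the inductive count. -/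
lemma cast_ncard_profileSet {t j : ℕ} (hj : j + (t + 1) = s) (m ℓ : ℕ) :
    ((h.profileSet n j m ℓ).ncard : ℝ) = if m ≤ ℓ then grassWeight q n m *
      (qPoch (1 / q) n / qPoch (1 / q) m) * chainSum (1 / q) (grassWeight q n) t m n (ℓ - m)
      else 0 := by
  have hfin := h.finite
  have hq := h.two_le
  have hq1 : (1 / q : ℝ) < 1 := by
    rw [div_lt_one (by positivity)]; exact_mod_cast hq
  have hx0 : (0 : ℝ) ≤ 1 / q := by positivity
  split_ifs with hm
  swap
  · rw [Nat.cast_eq_zero, Set.ncard_eq_zero, Set.eq_empty_iff_forall_notMem]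
    rintro N ⟨-, h1, h2⟩
    have h3 : q ^ m ≤ q ^ ℓ := by
      rw [← h1, h2]; exact Nat.le_mul_of_pos_right _ Nat.card_pos
    exact hm ((Nat.pow_le_pow_iff_right hq).mp h3)
  obtain ⟨ℓ', rfl⟩ := Nat.exists_eq_add_of_le hm
  rw [Nat.add_sub_cancel_left]
  induction t generalizing j m ℓ' with
  | zero =>
    have hL : h.layer (Fin n → R) (j + 1) = ⊥ := by
      rw [show j + 1 = s by omega, h.layer_self]
    have hf := h.cast_ncard_fiber (n := n) (j := j) (m := m) (N' := ⊥) (by omega) bot_le le_rfl (by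
      have : h.socle (⊥ : Submodule R (Fin n → R)) ⊥ = ⊥ := by
        ext x
        simp only [mem_socle, Submodule.mem_bot]
        exact ⟨fun hx => hx.1, fun hx => ⟨hx, by rw [hx, smul_zero]⟩⟩
      rw [hL, this])
    have hbot : Nat.card (⊥ : Submodule R (Fin n → R)) = 1 := Nat.card_unique
    rw [chainSum_zero]
    split_ifs with h0
    · subst h0
      rw [mul_div_assoc', ← mul_div_right_comm, ← hf]
      congr 2
      ext N
      simp only [profileSet, hL, inf_bot_eq, add_zero, Set.mem_ofPred_eq, hbot,
        mul_one, true_and, and_self]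
    · rw [mul_zero, Nat.cast_eq_zero, Set.ncard_eq_zero, Set.eq_empty_iff_forall_notMem]
      rintro N ⟨-, h1, h2⟩
      rw [hL, inf_bot_eq, hbot, mul_one, h1] at h2
      have := Nat.pow_right_injective hq h2
      omega
  | succ t ih =>
    set L := h.layer (Fin n → R) (j + 1) with hLdef
    have hdim : ∀ N : Submodule R (Fin n → R), ∃ m' ≤ n, Nat.card (N ⊓ L : Submodule R _) =
        q ^ m' * Nat.card (N ⊓ L ⊓ h.layer (Fin n → R) (j + 1 + 1) : Submodule R (Fin n → R)) :=
      fun N => h.exists_profile (by omega) inf_le_right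
    choose p hp1 hp2 using hdim
    rw [Set.ncard_eq_sum_ncard_fiber (t := Finset.range (n + 1)) (f := p) (Set.toFinite _)
      (Finset.finite_toSet _) (fun N _ => by simpa [Nat.lt_succ_iff] using hp1 N),
      Finset.finite_toSet_toFinset, Nat.cast_sum, chainSum_succ_eq_sum_range, Finset.mul_sum]
    refine Finset.sum_congr rfl fun m' hm' => ?_
    have hm' : m' ≤ n := Nat.lt_succ_iff.mp (Finset.mem_range.mp hm')
    have hqpos : ∀ i, 0 < q ^ i := fun i => pow_pos (by omega) i
    rw [Set.cast_ncard_eq_mul_of_ncard_fiber (t := h.profileSet n (j + 1) m' ℓ')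
      (f := fun N => N ⊓ L) (Set.toFinite _) (Set.toFinite _)
      (c := grassWeight q n m * qPoch (1 / q) m' * stepWeight (1 / q) m m' / qPoch (1 / q) m)]
    · have hcount : ((h.profileSet n (j + 1) m' ℓ').ncard : ℝ) =
          if m' ≤ ℓ' then grassWeight q n m' * (qPoch (1 / q) n / qPoch (1 / q) m') *
            chainSum (1 / q) (grassWeight q n) t m' n (ℓ' - m') else 0 := by
        split_ifs with hml
        · obtain ⟨c, rfl⟩ := Nat.exists_eq_add_of_le hml
          rw [Nat.add_sub_cancel_left]
          exact ih (by omega) m' c (by omega)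
        · rw [Nat.cast_eq_zero, Set.ncard_eq_zero, Set.eq_empty_iff_forall_notMem]
          rintro N ⟨-, h1, h2⟩
          have h3 : q ^ m' ≤ q ^ ℓ' := by
            rw [← h1, h2]; exact Nat.le_mul_of_pos_right _ Nat.card_pos
          exact hml ((Nat.pow_le_pow_iff_right hq).mp h3)
      rw [hcount]
      have p1 := (qPoch_pos hx0 hq1 m').ne'
      have p2 := (qPoch_pos hx0 hq1 m).ne'
      split_ifs
      · field_simp
      · ring
    · rintro N ⟨⟨h1, h2, h3⟩, rfl⟩
      refine ⟨inf_le_right, ?_, hp2 N⟩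
      rw [h2, pow_add] at h3
      exact (Nat.eq_of_mul_eq_mul_left (hqpos m) h3).symm
    · rintro N' ⟨h1, h2, h3⟩
      rw [← h.cast_ncard_fiber (j := j) (m := m) (by omega) h1 hm']
      · congr 2
        ext N
        constructor
        · rintro ⟨⟨⟨h4, h5, h6⟩, h7⟩, h8⟩
          have h8 : N ⊓ L = N' := h8
          exact ⟨h4, h8, by rw [← h8]; exact h6⟩
        · rintro ⟨h4, h5, h6⟩
          refine ⟨⟨⟨h4, ?_, ?_⟩, ?_⟩, h5⟩
          · rw [h6, h2, pow_add]
          · rw [← hLdef, h5, h6]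
          · have h7 := hp2 N
            rw [h5, h3] at h7
            have := Nat.eq_of_mul_eq_mul_right Nat.card_pos h7
            exact (Nat.pow_right_injective hq this).symm
      -- The profile `m'` of `N'` determines the size of the socle over `N'` inside `L`.
      · have e1 := h.card_socle_mul (A := h.layer (Fin n → R) (j + 1))
          (B := h.layer (Fin n → R) (j + 1 + 1)) (N := N')
          (fun x hx => h.smul_mem_layer hx) (fun y hy => h.exists_smul_eq_of_mem_layer hy)
        have e2 := Submodule.card_sup_mul_card_inf N' (h.layer (Fin n → R) (j + 1 + 1))
        rw [h.card_layer (by omega)] at e1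
        have hpos : 0 < Nat.card (N' ⊓ h.layer (Fin n → R) (j + 1 + 1) : Submodule R _) :=
          Nat.card_pos
        have hpos2 : 0 < Nat.card (h.layer (Fin n → R) (j + 1 + 1)) := Nat.card_pos
        rw [h3] at e2 ⊢
        set a := Nat.card (N' ⊓ h.layer (Fin n → R) (j + 1 + 1) : Submodule R _)
        set b := Nat.card (h.layer (Fin n → R) (j + 1 + 1))
        have e3 : Nat.card (N' ⊔ h.layer (Fin n → R) (j + 1 + 1) : Submodule R _) = q ^ m' * b :=
          Nat.eq_of_mul_eq_mul_right hpos (by rw [e2]; ring)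
        rw [e3, h3] at e1
        refine Nat.eq_of_mul_eq_mul_right hpos2 ?_
        linarith

lemma cast_ncard_submodulesOfLength (ℓ : ℕ) : ((submodulesOfLength R n ℓ).ncard : ℝ) =
    qPoch (1 / q) n * chainSum (1 / q) (grassWeight q n) s 0 n ℓ := by
  have hfin := h.finite
  have hq := h.two_le
  obtain ⟨t, rfl⟩ := Nat.exists_eq_succ_of_ne_zero h.pos.ne'
  have hdim : ∀ N : Submodule R (Fin n → R), ∃ m ≤ n, Nat.card N =
      q ^ m * Nat.card (N ⊓ h.layer (Fin n → R) (0 + 1) : Submodule R (Fin n → R)) :=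
    fun N => h.exists_profile h.pos (by rw [h.layer_zero]; exact le_top)
  choose p hp1 hp2 using hdim
  rw [Set.ncard_eq_sum_ncard_fiber (t := Finset.range (n + 1)) (f := p) (Set.toFinite _)
    (Finset.finite_toSet _) (fun N _ => by simpa [Nat.lt_succ_iff] using hp1 N),
    Finset.finite_toSet_toFinset, Nat.cast_sum, chainSum_succ_eq_sum_range, Finset.mul_sum]
  refine Finset.sum_congr rfl fun m hm => ?_
  have : {N ∈ submodulesOfLength R n ℓ | p N = m} = h.profileSet n 0 m ℓ := by
    ext N
    simp only [submodulesOfLength, profileSet, Set.mem_ofPred_eq, h.length_eq_iff_card_eq,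
      h.layer_zero, le_top, true_and]
    refine and_congr_right fun _ => ⟨fun hN => hN ▸ hp2 N, fun hN => ?_⟩
    rw [hp2 N] at hN
    exact Nat.pow_right_injective hq (Nat.eq_of_mul_eq_mul_right Nat.card_pos hN)
  rw [this, h.cast_ncard_profileSet (t := t) (by omega), stepWeight_zero_left]
  split_ifs <;> ring

end IsUniformizer

/-! ### Free submodules and the exact density. -/

namespace IsUniformizer

open Submodule

variable {R : Type u} [Ring R] {π : R} {q s : ℕ} (h : IsUniformizer π q s) {n : ℕ}

include h

lemma mem_layer_one_iff {x : Fin n → R} :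
    x ∈ h.layer (Fin n → R) 1 ↔ π ^ (s - 1) • x = 0 := by
  have hs := h.pos
  refine ⟨?_, h.mem_layer_one_of_pow_smul_eq_zero (by omega)⟩
  rintro ⟨y, rfl⟩
  rw [pow_one, ← mul_smul, ← pow_succ, Nat.sub_add_cancel hs, h.pow_eq_zero, zero_smul]

lemma card_layer_eq_pow {j : ℕ} (hj : j ≤ s) :
    Nat.card (h.layer (Fin n → R) j) = q ^ (n * (s - j)) := by
  induction hj using Nat.decreasingInduction with
  | self => rw [h.layer_self, Nat.sub_self, mul_zero, pow_zero]; exact Nat.card_unique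
  | of_succ j hj ih =>
    rw [h.card_layer hj, ih, ← pow_add, show s - j = s - (j + 1) + 1 by omega]
    ring

lemma card_pi : Nat.card (Fin n → R) = q ^ (s * n) := by
  have := h.card_layer_eq_pow (n := n) (Nat.zero_le s)
  rwa [h.layer_zero, Nat.card_congr Submodule.topEquiv.toEquiv, Nat.sub_zero, mul_comm] at this

/-- Layer 1 is the set of vectors killed by `π ^ (s - 1)`, so an isomorphism `N ≃ R ^ k` carries `N
⊓ L` to layer 1 of `R ^ k`. -/
lemma profile_of_free {k : ℕ} {N : Submodule R (Fin n → R)} (hN : Nat.card N = q ^ (s * k))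
    [Module.Free R N] :
    Nat.card N = q ^ k * Nat.card (N ⊓ h.layer (Fin n → R) 1 : Submodule R (Fin n → R)) := by
  have hfin := h.finite
  have e : ∃ d, Nonempty (N ≃ₗ[R] (Fin d → R)) := by
    have b := Module.Free.chooseBasis R N
    have : Nontrivial R := ⟨1, 0, fun h10 => h.pow_ne_zero 0 h.pos (by rw [pow_zero, h10])⟩
    exact ⟨_, ⟨(b.reindex (Fintype.equivFin _)).equivFun⟩⟩
  obtain ⟨d, ⟨e⟩⟩ := e
  have hd : Nat.card N = Nat.card (Fin d → R) := Nat.card_congr e.toEquiv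
  have hdk : k = d := by
    rw [hN, h.card_pi] at hd
    exact Nat.eq_of_mul_eq_mul_left h.pos (Nat.pow_right_injective h.two_le hd)
  subst hdk
  have himg : ((N ⊓ h.layer (Fin n → R) 1 : Submodule R (Fin n → R)) : Set (Fin n → R)) =
      (fun y => (e.symm y : Fin n → R)) '' (h.layer (Fin k → R) 1) := by
    ext x
    constructor
    · rintro ⟨h1, h2⟩
      have h2 := h.mem_layer_one_iff.mp h2
      refine ⟨e ⟨x, h1⟩, h.mem_layer_one_iff.mpr ?_, by simp⟩
      rw [← map_smul, show π ^ (s - 1) • (⟨x, h1⟩ : N) = 0 from Subtype.ext h2, map_zero]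
    · rintro ⟨y, hy, rfl⟩
      have hy := h.mem_layer_one_iff.mp hy
      refine ⟨(e.symm y).2, h.mem_layer_one_iff.mpr ?_⟩
      rw [← Submodule.coe_smul, ← map_smul, hy, map_zero, Submodule.coe_zero]
  have hc : Nat.card (N ⊓ h.layer (Fin n → R) 1 : Submodule R (Fin n → R)) =
      Nat.card (h.layer (Fin k → R) 1) := by
    have := congrArg Set.ncard himg
    rw [Set.ncard_image_of_injective _ (fun a b hab =>
      e.symm.injective (Subtype.ext hab))] at this
    exact this
  rw [hd, hc, h.card_eq_pow_mul_card_layer_one]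

lemma not_isUnit_of_sum_mem {l : List (Fin n → R)}
    (hl : (h.layer (Fin n → R) 1).IsIndepList l) {u : Fin l.length → R}
    (hu : ∑ i, u i • l.get i ∈ h.layer (Fin n → R) 1) (i : Fin l.length) : ¬ IsUnit (u i) := by
  induction l with
  | nil => exact i.elim0
  | cons v l ih =>
    set L := h.layer (Fin n → R) 1
    have hsum : ∑ i, u i • (v :: l).get i =
        u 0 • v + ∑ i : Fin l.length, u i.succ • l.get i := Fin.sum_univ_succ _
    have h0 : ¬ IsUnit (u 0) := by
      intro hunit
      refine hl.1 (((L.adjoinList R l).smul_mem_iff_of_isUnit hunit).mp ?_)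
      have h1 : ∑ i : Fin l.length, u i.succ • l.get i ∈ L.adjoinList R l :=
        sum_mem fun i _ => smul_mem _ _ (mem_adjoinList L (List.get_mem l i))
      have h2 := sub_mem (le_adjoinList L l hu) h1
      rwa [hsum, add_sub_cancel_right] at h2
    refine Fin.cases h0 (fun i => ?_) i
    refine ih hl.2 (u := fun i => u i.succ) ?_ i
    have h3 : u 0 • v ∈ L := by
      obtain ⟨a, ha⟩ := (h.mem_or_isUnit (u 0)).resolve_right h0
      obtain ⟨b, hb⟩ := h.right_of_left a
      exact ⟨b • v, by rw [ha, hb, mul_smul, pow_one]⟩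
    have h4 := sub_mem hu h3
    rwa [hsum, add_sub_cancel_left] at h4

/-- Lift `k` elements independent modulo layer 1. They define an injection `R ^ k → N`, which is
bijective by cardinality. -/
lemma free_of_profile {k : ℕ} {N : Submodule R (Fin n → R)} (hN : Nat.card N = q ^ (s * k))
    (hp : Nat.card N =
      q ^ k * Nat.card (N ⊓ h.layer (Fin n → R) 1 : Submodule R (Fin n → R))) :
    Module.Free R N := by
  have hfin := h.finite
  have hq := h.two_le
  set L := h.layer (Fin n → R) 1
  have hsmul : ∀ v ∈ N, π • v ∈ N ⊓ L := fun v hv =>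
    ⟨N.smul_mem _ hv, ⟨v, by rw [pow_one]⟩⟩
  have hcount := h.ncard_indepLists (inf_le_left : N ⊓ L ≤ N) hsmul k
  have hpos : 0 < ((N ⊓ L).indepLists N k).ncard := by
    rw [hcount]
    refine Finset.prod_pos fun i hi => Nat.sub_pos_of_lt ?_
    rw [hp]
    exact Nat.mul_lt_mul_of_pos_right (Nat.pow_lt_pow_right (by omega)
      (Finset.mem_range.mp hi)) Nat.card_pos
  obtain ⟨l, rfl, hl2, hl3⟩ := Set.nonempty_of_ncard_ne_zero hpos.ne'
  have hl := hl2.of_inf_eq rfl hl3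
  set φ : (Fin l.length → R) →ₗ[R] N := Fintype.linearCombination R
    (fun i => (⟨l.get i, hl3 _ (List.get_mem l i)⟩ : N)) with hφ
  have hφv : ∀ u, (φ u : Fin n → R) = ∑ i, u i • l.get i := fun u => by
    simp [hφ, Fintype.linearCombination_apply]
  have hinj : Function.Injective φ := by
    rw [injective_iff_map_eq_zero]
    intro u hu
    -- A relation with coefficients `π ^ t • w` puts `∑ w i • l i` in layer 1; independence then
    -- makes every `w i` divisible by `π`.
    have key : ∀ t ≤ s, u ∈ h.layer (Fin l.length → R) t := by
      intro t
      induction t with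
      | zero => intro _; rw [h.layer_zero]; trivial
      | succ t ih =>
        intro ht
        obtain ⟨w, rfl⟩ := ih (by omega)
        rw [map_smul] at hu
        have h1 : (φ w : Fin n → R) ∈ L := by
          refine h.mem_layer_one_of_pow_smul_eq_zero (a := t) (by omega) ?_
          rw [← Submodule.coe_smul, hu, Submodule.coe_zero]
        rw [hφv] at h1
        have h2 : ∀ i, ∃ b, w i = π * b := by
          intro i
          obtain ⟨a, ha⟩ := (h.mem_or_isUnit (w i)).resolve_right (h.not_isUnit_of_sum_mem hl h1 i)
          obtain ⟨b, hb⟩ := h.right_of_left a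
          exact ⟨b, by rw [ha, hb]⟩
        choose b hb using h2
        refine ⟨b, ?_⟩
        rw [pow_succ, mul_smul]
        congr 1
        ext i
        simp [hb i]
    have := key s le_rfl
    rwa [h.layer_self, Submodule.mem_bot] at this
  have hbij : Function.Bijective φ :=
    hinj.bijective_of_nat_card_le (by rw [hN, h.card_pi])
  exact Module.Free.of_equiv (LinearEquiv.ofBijective φ hbij)

lemma freeSubmodulesOfLength_eq (k : ℕ) :
    freeSubmodulesOfLength R n (s * k) = h.profileSet n 0 k (s * k) := by
  have hfin := h.finite
  ext N
  simp only [freeSubmodulesOfLength, submodulesOfLength, profileSet, Set.mem_ofPred_eq,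
    h.length_eq_iff_card_eq, h.layer_zero, le_top, true_and, zero_add]
  exact and_congr_right fun hN => ⟨fun hf => h.profile_of_free hN, fun hp => h.free_of_profile hN hp⟩

lemma freeProbability_eq_freeRatio (k r : ℕ) :
    freeProbability R (k + r) (s * k) = freeRatio (1 / q) k r s := by
  have hq := h.two_le
  have hq0 : (q : ℝ) ≠ 0 := by positivity
  have hq1 : (1 / q : ℝ) < 1 := by
    rw [div_lt_one (by positivity)]; exact_mod_cast hq
  have hx0 : (0 : ℝ) ≤ 1 / q := by positivity
  obtain ⟨t, rfl⟩ := Nat.exists_eq_succ_of_ne_zero h.pos.ne'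
  rw [freeProbability, h.freeSubmodulesOfLength_eq, h.cast_ncard_submodulesOfLength,
    h.cast_ncard_profileSet (t := t) (by omega), if_pos (Nat.le_mul_of_pos_left k (Nat.succ_pos t)),
    show (t + 1) * k - k = t * k + 0 by rw [Nat.succ_mul]; omega]
  have hscale := grassWeight_eq (q := q) (by omega) (k + r) k
  have hw : centeredWeight (1 / q : ℝ) k k = 1 := by simpa using centeredWeight_add (x := 1 / q) k 0
  rw [chainSum_scale hscale, chainSum_scale hscale, hscale k, hw]
  -- After a first entry `k`, the remaining `t` entries have total `t * k` and must all equal `k`.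
  have h1 := chainSum_centeredWeight_shift (x := 1 / q) k t 0 r 0
  rw [add_zero, chainSum_bot_right_zero _ _ (by simp), stepWeight_zero_left] at h1
  rw [h1, add_zero, freeRatio]
  have p0 := (qPoch_pos hx0 hq1 (k + r)).ne'
  have p1 := (qPoch_pos hx0 hq1 k).ne'
  have p2 := (qPoch_pos hx0 hq1 r).ne'
  have hz : (q : ℝ) ^ (((k + r : ℕ) : ℤ) - 2 * k) ≠ 0 := zpow_ne_zero _ hq0
  set c := (q : ℝ) ^ k ^ 2 with hc
  have hc0 : c ≠ 0 := _root_.pow_ne_zero _ hq0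
  set z := (q : ℝ) ^ (((k + r : ℕ) : ℤ) - 2 * k)
  have hfac : c ^ (t + 1) * z ^ ((t + 1) * k) * qPoch (1 / q) (k + r) ≠ 0 :=
    mul_ne_zero (mul_ne_zero (_root_.pow_ne_zero _ hc0) (_root_.pow_ne_zero _ hz)) p0
  have e1 : c * z ^ k * 1 * (qPoch (1 / q) (k + r) / qPoch (1 / q) k) *
      (c ^ t * z ^ (t * k) * (1 / qPoch (1 / q) r)) =
      c ^ (t + 1) * z ^ ((t + 1) * k) * qPoch (1 / q) (k + r) /
        (qPoch (1 / q) k * qPoch (1 / q) r) := by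
    rw [Nat.succ_mul, pow_add z, pow_succ c]
    field_simp
  rw [e1, div_div, ← mul_div_mul_left 1 (_ * chainSum _ _ _ _ _ _) hfac, mul_one]
  congr 1
  simp only [Nat.succ_eq_add_one]
  ring

end IsUniformizer

/-! ### The two limits. -/

lemma one_div_le_half {q : ℕ} (hq : 2 ≤ q) : (1 / q : ℝ) ≤ 1 / 2 :=
  one_div_le_one_div_of_le two_pos (by exact_mod_cast hq)

lemma freeProbability_le_one (R : Type u) [Ring R] [Finite R] (n ℓ : ℕ) :
    freeProbability R n ℓ ≤ 1 := by
  refine div_le_one_of_le₀ (Nat.cast_le.mpr (Set.ncard_le_ncard (fun N hN => hN.1) ?_))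
    (Nat.cast_nonneg _)
  exact Set.toFinite _

theorem mainTheorem5 :
    (∀ (n s ℓ : ℕ), s ∣ ℓ → ℓ ≤ s * n →
      ∀ (R : ℕ → Type u) [∀ j, Ring (R j)] (q : ℕ → ℕ),
        (∀ j, IsFiniteChainRing (R j) (q j) s) → Tendsto q atTop atTop →
          Tendsto (fun j => freeProbability (R j) n ℓ) atTop (𝓝 1)) ∧
    (∀ (n k q : ℕ), k ≤ n →
      ∃ d : ℝ, eulerFunction (1 / (q : ℝ)) ≤ d ∧
        ∀ (R : ℕ → Type u) [∀ j, Ring (R j)] (s : ℕ → ℕ),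
          (∀ j, IsFiniteChainRing (R j) q (s j)) → Tendsto s atTop atTop →
            Tendsto (fun j => freeProbability (R j) n (s j * k)) atTop (𝓝 d)) := by
  refine ⟨?_, ?_⟩
  · rintro n s _ ⟨k, rfl⟩ hle R _ q hR hq
    obtain ⟨π, hπ⟩ := (hR 0).exists_isUniformizer
    obtain ⟨r, rfl⟩ := Nat.exists_eq_add_of_le (Nat.le_of_mul_le_mul_left hle hπ.pos)
    have hlow : Tendsto (fun j => 1 - 2 * (1 / (q j : ℝ))) atTop (𝓝 1) := by
      have h0 : Tendsto (fun j => 1 / (q j : ℝ)) atTop (𝓝 0) :=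
        tendsto_one_div_atTop_nhds_zero_nat.comp hq
      simpa using (h0.const_mul 2).const_sub 1
    refine tendsto_of_tendsto_of_tendsto_of_le_of_le hlow tendsto_const_nhds (fun j => ?_)
      (fun j => ?_)
    · obtain ⟨π, hπ⟩ := (hR j).exists_isUniformizer
      simp only [hπ.freeProbability_eq_freeRatio]
      exact one_sub_two_mul_le_freeRatio k r (by positivity) (one_div_le_half hπ.two_le) hπ.pos
    · have := (hR j).finite
      exact freeProbability_le_one _ _ _
  · intro n k q hk
    obtain ⟨r, rfl⟩ := Nat.exists_eq_add_of_le hk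
    by_cases hq : 2 ≤ q
    · obtain ⟨d, hd, hlim⟩ := exists_tendsto_freeRatio (x := 1 / q) k r (by positivity)
        (one_div_le_half hq)
      refine ⟨d, hd, fun R _ s hR hs => (hlim.comp hs).congr fun j => ?_⟩
      obtain ⟨π, hπ⟩ := (hR j).exists_isUniformizer
      exact (hπ.freeProbability_eq_freeRatio k r).symm
    -- No residue field has fewer than two elements, so any admissible `d` will do.
    · refine ⟨_, le_rfl, fun R _ s hR _ => ?_⟩
      obtain ⟨π, hπ⟩ := (hR 0).exists_isUniformizer
      exact absurd hπ.two_le hq
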